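/- Let $m\ge 0$, $p\in(1,\infty)$, and let $V=(V_{ij})_{i,j=1}^2:\mathbb R\to\mathbb C^{2\times 2}$ be a (not necessarily Hermitian) matrix-valued potential with $V_{ij}\in L^p(\mathbb R)$ for $i,j=1,2$. Set $$\|V\|_p:=\Big(\int_{\mathbb R}\|V(x)\|^p\,dx\Big)^{1/p},$$ where $\|V(x)\|$ is the operator norm of $V(x)$ on $\mathbb C^2$ with the Euclidean norm. Let $H=H_0+V$ be the one-dimensional Dirac operator in $L^2(\mathbb R)\otimes\mathbb C^2$, where $$H_0=-i\frac{d}{dx}\sigma_1+m\sigma_3,\qquad \sigma_1=\begin{pmatrix}0&1\\1&0\end{pmatrix},\quad \sigma_3=\begin{pmatrix}1&0\\0&-1\end{pmatrix};$$ precisely, $\operatorname{dom}(H)$ consists of all locally absolutely continuous $f\in L^2(\mathbb R)\otimes\mathbb C^2$ with $-i\sigma_1f'+m\sigma_3f+Vf\in L^2(\mathbb R)\otimes\mathbb C^2$, and $Hf=-i\sigma_1f'+m\sigma_3f+Vf$. Let $z\in\mathbb C\setminus\big((-\infty,-m]\cup[m,\infty)\big)$, let $\sqrt{z^2-m^2}$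 denote the square root with positive imaginary part, and set $$\Phi(z)=\frac{z+m}{z-m},\qquad \eta(s)=\sqrt{\tfrac12+\tfrac14\,(s+s^{-1})}\quad(s>0).$$ If $$\eta(|\Phi(z)|)\,\Big(\frac{2(p-1)}{p}\Big)^{(p-1)/p}\,\big(\operatorname{Im}\sqrt{z^2-m^2}\,\big)^{-(p-1)/p}\,\|V\|_p<1,$$ then $z\notin\sigma(H)$, that is, $H-z$ maps $\operatorname{dom}(H)$ bijectively onto $L^2(\mathbb R)\otimes\mathbb C^2$ and has a bounded inverse. -/

import Mathlib

open MeasureTheory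

noncomputable section

namespace Dirac1D

/-- `ℂ²` with its Euclidean norm. -/
abbrev Spinor : Type := EuclideanSpace ℂ (Fin 2)

/-- The Hilbert space `L²(ℝ) ⊗ ℂ² = L²(ℝ; ℂ²)`. -/
abbrev Hilb : Type := Lp Spinor 2 (volume : Measure ℝ)

/-- The linear map of `ℂ²` given by a `2 × 2` matrix. -/
abbrev act (M : Matrix (Fin 2) (Fin 2) ℂ) : Spinor →L[ℂ] Spinor :=
  Matrix.toEuclideanCLM (n := Fin 2) (𝕜 := ℂ) M

def sigma1 : Matrix (Fin 2) (Fin 2) ℂ := !![0, 1; 1, 0]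

def sigma3 : Matrix (Fin 2) (Fin 2) ℂ := !![1, 0; 0, -1]

/-- `f` is (almost everywhere equal to) a locally absolutely continuous function whose almost
everywhere derivative is the locally integrable function `u`. -/
def HasACDeriv (f u : ℝ → Spinor) : Prop :=
  LocallyIntegrable u volume ∧
    ∃ F : ℝ → Spinor, f =ᵐ[volume] F ∧ ∀ a b : ℝ, F b - F a = ∫ x in a..b, u x

theorem HasACDeriv.zero : HasACDeriv 0 0 :=
  ⟨locallyIntegrable_zero, 0, Filter.EventuallyEq.rfl, fun a b => by simp⟩

theorem HasACDeriv.intervalIntegrable {f u : ℝ → Spinor} (h : HasACDeriv f u) (a b : ℝ) :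
    IntervalIntegrable u volume a b :=
  intervalIntegrable_iff.mpr
    ((h.1.integrableOn_isCompact isCompact_uIcc).mono_set Set.uIoc_subset_uIcc)

theorem HasACDeriv.add {f u g v : ℝ → Spinor} (hf : HasACDeriv f u) (hg : HasACDeriv g v) :
    HasACDeriv (f + g) (u + v) := by
  have hfi := hf.intervalIntegrable
  have hgi := hg.intervalIntegrable
  obtain ⟨hu, F, hF, hFu⟩ := hf
  obtain ⟨hv, G, hG, hGv⟩ := hg
  refine ⟨hu.add hv, F + G, hF.add hG, fun a b => ?_⟩
  have h1 : ∫ x in a..b, (u + v) x = (∫ x in a..b, u x) + ∫ x in a..b, v x :=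
    intervalIntegral.integral_add (hfi a b) (hgi a b)
  rw [h1, ← hFu, ← hGv]
  simp only [Pi.add_apply]
  abel

theorem HasACDeriv.smul {f u : ℝ → Spinor} (c : ℂ) (hf : HasACDeriv f u) :
    HasACDeriv (c • f) (c • u) := by
  obtain ⟨hu, F, hF, hFu⟩ := hf
  refine ⟨hu.smul c, c • F, hF.const_smul c, fun a b => ?_⟩
  simp only [Pi.smul_apply, intervalIntegral.integral_smul, ← hFu, smul_sub]

theorem HasACDeriv.ae_eq_zero {f u : ℝ → Spinor} (h : HasACDeriv f u)
    (hf : f =ᵐ[volume] 0) : u =ᵐ[volume] 0 := by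
  have hi := h.intervalIntegrable
  obtain ⟨hu, F, hF, hFu⟩ := h
  have hFc : Continuous F := by
    have h1 : F = fun b => F 0 + ∫ x in (0 : ℝ)..b, u x := by
      funext b
      rw [← hFu 0 b]
      abel
    rw [h1]
    exact continuous_const.add (intervalIntegral.continuous_primitive hi 0)
  have hF0 : F = 0 :=
    (hFc.ae_eq_iff_eq volume (continuous_zero)).mp (hF.symm.trans hf)
  filter_upwards [LocallyIntegrable.ae_hasDerivAt_integral hu] with x hx
  have h2 : (fun y => ∫ t in (0 : ℝ)..y, u t) = fun _ => (0 : Spinor) := by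
    funext y
    rw [← hFu 0 y, hF0]
    simp
  have h3 := hx 0
  rw [h2] at h3
  exact h3.unique (hasDerivAt_const x 0)

/-- The graph of the Dirac operator in `L²(ℝ; ℂ²)` with mass `m` and potential `V`, realised on
its maximal domain: `(f, g)` belongs to it iff `f ∈ L²` is locally absolutely continuous and
`g = -i σ₁ f' + m σ₃ f + V f` almost everywhere, with `g ∈ L²`. -/
def diracGraph (m : ℝ) (V : ℝ → Matrix (Fin 2) (Fin 2) ℂ) : Submodule ℂ (Hilb × Hilb) where
  carrier := {q | ∃ u : ℝ → Spinor, HasACDeriv q.1 u ∧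
    ∀ᵐ x : ℝ, q.2 x = -Complex.I • act sigma1 (u x) + (m : ℂ) • act sigma3 (q.1 x)
      + act (V x) (q.1 x)}
  zero_mem' := by
    have h0 := Lp.coeFn_zero Spinor 2 (volume : Measure ℝ)
    refine ⟨0, ⟨locallyIntegrable_zero, 0, h0, fun a b => by simp⟩, ?_⟩
    exact Filter.Eventually.of_forall fun x => by simp
  add_mem' := by
    rintro ⟨f, g⟩ ⟨f', g'⟩ ⟨u, hu, hg⟩ ⟨u', hu', hg'⟩
    have hf := Lp.coeFn_add f f'
    refine ⟨u + u', ?_, ?_⟩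
    · obtain ⟨h1, F, hF, h2⟩ := hu.add hu'
      exact ⟨h1, F, hf.trans hF, h2⟩
    · filter_upwards [hf, Lp.coeFn_add g g', hg, hg'] with x h1 h2 h3 h4
      simp only [Prod.mk_add_mk, h1, h2, Pi.add_apply, map_add, smul_add]
      rw [h3, h4]
      abel
  smul_mem' := by
    rintro c ⟨f, g⟩ ⟨u, hu, hg⟩
    have hf := Lp.coeFn_smul c f
    refine ⟨c • u, ?_, ?_⟩
    · obtain ⟨h1, F, hF, h2⟩ := hu.smul c
      exact ⟨h1, F, hf.trans hF, h2⟩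
    · filter_upwards [hf, Lp.coeFn_smul c g, hg] with x h1 h2 h3
      simp only [Prod.smul_mk, h1, h2, Pi.smul_apply, map_smul]
      rw [h3]
      simp only [smul_add, smul_comm c]

/-- The graph is single-valued, so it is the graph of an operator. -/
theorem diracGraph_single_valued (m : ℝ) (V : ℝ → Matrix (Fin 2) (Fin 2) ℂ)
    (q : Hilb × Hilb) (hq : q ∈ diracGraph m V) (h0 : q.1 = 0) : q.2 = 0 := by
  obtain ⟨u, hu, hg⟩ := hq
  have hf : (q.1 : ℝ → Spinor) =ᵐ[volume] 0 := by
    rw [h0]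
    exact Lp.coeFn_zero Spinor 2 (volume : Measure ℝ)
  rw [Lp.eq_zero_iff_ae_eq_zero]
  filter_upwards [hg, hf, hu.ae_eq_zero hf] with x h1 h2 h3
  rw [h1, h2, h3]
  simp

/-- The Dirac operator `H = H₀ + V`, `H₀ = -i (d/dx) σ₁ + m σ₃`, in `L²(ℝ; ℂ²)` on its maximal
domain. For `V = 0` this is `H₀` on the Sobolev space `H¹(ℝ; ℂ²)`. -/
def diracOp (m : ℝ) (V : ℝ → Matrix (Fin 2) (Fin 2) ℂ) : Hilb →ₗ.[ℂ] Hilb :=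
  (diracGraph m V).toLinearPMap

theorem diracOp_graph (m : ℝ) (V : ℝ → Matrix (Fin 2) (Fin 2) ℂ) :
    (diracOp m V).graph = diracGraph m V :=
  Submodule.toLinearPMap_graph_eq _ (diracGraph_single_valued m V)

/-- The resolvent set of an unbounded operator `T`: those `z` for which `T - z` maps `dom T`
bijectively onto the whole space and has a bounded inverse `R`. -/
def resolventSet {E : Type*} [NormedAddCommGroup E] [NormedSpace ℂ E] (T : E →ₗ.[ℂ] E) : Set ℂ :=
  {z | ∃ R : E →L[ℂ] E,
    (∀ h : E, ∃ hR : R h ∈ T.domain, T ⟨R h, hR⟩ - z • R h = h) ∧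
      ∀ f : T.domain, R (T f - z • (f : E)) = f}

/-- The spectrum of an unbounded operator. -/
def spectrum {E : Type*} [NormedAddCommGroup E] [NormedSpace ℂ E] (T : E →ₗ.[ℂ] E) : Set ℂ :=
  (resolventSet T)ᶜ

/-- The branch of the square root on `ℂ \ [0, ∞)` with values in the upper half plane
(`Complex.sqrt` is the principal branch). -/
def sqrtUp (w : ℂ) : ℂ := Complex.I * Complex.sqrt (-w)

theorem sqrtUp_sq (w : ℂ) : sqrtUp w ^ 2 = w := by
  have h : Complex.sqrt (-w) ^ 2 = -w := Complex.cpow_nat_inv_pow (-w) two_ne_zero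
  rw [sqrtUp, mul_pow, h, Complex.I_sq]
  ring

theorem sqrtUp_im_pos {w : ℂ} (hw : ∀ t : ℝ, 0 ≤ t → w ≠ t) : 0 < (sqrtUp w).im := by
  have h0 : -w ≠ 0 := by
    intro h
    exact hw 0 le_rfl (by simpa using h)
  have harg : Complex.arg (-w) ≠ Real.pi := by
    intro h
    obtain ⟨h1, h2⟩ := Complex.arg_eq_pi_iff.mp h
    simp only [Complex.neg_re, Complex.neg_im] at h1 h2
    exact hw w.re (by linarith) (Complex.ext (by simp) (by simpa using h2))
  have hlt : Complex.arg (-w) < Real.pi := lt_of_le_of_ne (Complex.arg_le_pi _) harg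
  have hgt := Complex.neg_pi_lt_arg (-w)
  have him : ((2 : ℂ)⁻¹ * Complex.log (-w)).im = Complex.arg (-w) / 2 := by
    have h2 : (2 : ℂ)⁻¹ = ((2⁻¹ : ℝ) : ℂ) := by simp
    rw [h2, Complex.im_ofReal_mul, Complex.log_im]
    ring
  simp only [sqrtUp, Complex.sqrt, Complex.cpow_def_of_ne_zero h0, Complex.mul_im, Complex.I_re,
    Complex.I_im, zero_mul, one_mul, zero_add]
  rw [mul_comm, Complex.exp_re, him]
  exact mul_pos (Real.exp_pos _)
    (Real.cos_pos_of_mem_Ioo ⟨by linarith, by linarith⟩)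

/-- `k(z) = √(z² - m²)`, with `Im k(z) > 0`. -/
def waveNumber (m : ℝ) (z : ℂ) : ℂ := sqrtUp (z ^ 2 - (m : ℂ) ^ 2)

/-- `Φ(z) = (z + m) / (z - m)`. -/
def Phi (m : ℝ) (z : ℂ) : ℂ := (z + m) / (z - m)

/-- `η(s) = √(1/2 + (s + s⁻¹)/4)`. -/
def eta (s : ℝ) : ℝ := Real.sqrt (1 / 2 + (1 / 4) * (s + s⁻¹))

/-- `‖V‖_p = (∫ ‖V(x)‖^p dx)^{1/p}`, where `‖V(x)‖` is the operator norm of `V(x)` on Euclidean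
`ℂ²`. -/
def potNorm (p : ℝ) (V : ℝ → Matrix (Fin 2) (Fin 2) ℂ) : ℝ :=
  (∫ x : ℝ, ‖act (V x)‖ ^ p) ^ (1 / p)

end Dirac1D

end

noncomputable section

namespace Dirac1D

open Set Filter Topology
open scoped ENNReal

/-! Write `k = √(z² - m²)` and `κ = Im k > 0`. Since `σ₁² = 1`, the equation `(H - z)f = h` is the
first order system `F' = M F + J(h - V F)` with `M = iσ₁(z - mσ₃)` and `J = iσ₁`. The matrix `M` has
eigenvalues `±ik` with complementary rank-one projections `P`, `Q`, so the free resolvent has the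
kernel `e^{ik|x-y|}` times `PJ` for `y ≤ x` and `-QJ` for `x < y`. With `ζ = (z + m)/k`, `|ζ|² =
|Φ(z)|`, the projections have norm at most `η(|Φ(z)|)` (`norm_act_spectralProj_le`), so the kernel
is bounded by `η e^{-κ|x-y|}`.

Hölder's inequality (`integral_exp_mul_le`) gives `∫ e^{-κ|x-y|} ‖V(y)‖ dy ≤ Θ` uniformly in `x`,
and the hypothesis becomes `η Θ < 1`. This one inequality is used twice.

Surjectivity (`exists_right_inverse`) is a Birman–Schwinger argument. Split `V = sU` with `|s|² =
‖U‖² = ‖V‖`. A Schur test bounds the operator `K` with kernel `s(x) G(x,y) U(y)` by `η Θ < 1`, so `1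
+ K` is invertible and `R = R₀ - (R₀U)(1 + K)⁻¹(sR₀)` is a bounded right inverse of `H - z`.

Injectivity (`eq_zero_of_mem_diracGraph`) is a maximum argument. On `[a, b]` the kernel bound gives
`(1 - ηΘ)|F| ≤ ‖P‖|F(a)| + ‖Q‖|F(b)|`, and an `L²` function is small at suitable far away `a` and
`b`. A bounded right inverse of an injective operator is its two-sided inverse. -/

/-- `Ψ` is locally absolutely continuous with almost everywhere derivative `ψ`. -/
def IsPrimitive {E : Type*} [NormedAddCommGroup E] [NormedSpace ℝ E] (Ψ ψ : ℝ → E) : Prop :=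
  LocallyIntegrable ψ volume ∧ ∀ a b : ℝ, Ψ b - Ψ a = ∫ x in a..b, ψ x

theorem intervalIntegrable_of_locallyIntegrable {E : Type*} [NormedAddCommGroup E]
    {u : ℝ → E} (h : LocallyIntegrable u volume) (a b : ℝ) : IntervalIntegrable u volume a b :=
  intervalIntegrable_iff.mpr
    ((h.integrableOn_isCompact isCompact_uIcc).mono_set Set.uIoc_subset_uIcc)

/-! ### Calculus of locally absolutely continuous functions -/

namespace IsPrimitive

variable {E : Type*} [NormedAddCommGroup E] [NormedSpace ℂ E] {Ψ ψ Ψ' ψ' : ℝ → E}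

theorem intervalIntegrable (h : IsPrimitive Ψ ψ) (a b : ℝ) : IntervalIntegrable ψ volume a b :=
  intervalIntegrable_of_locallyIntegrable h.1 a b

theorem eq_add_integral (h : IsPrimitive Ψ ψ) :
    Ψ = fun b => Ψ 0 + ∫ x in (0 : ℝ)..b, ψ x := by
  funext b
  rw [← h.2 0 b]
  abel

theorem continuous (h : IsPrimitive Ψ ψ) : Continuous Ψ := by
  rw [h.eq_add_integral]
  exact continuous_const.add (intervalIntegral.continuous_primitive h.intervalIntegrable 0)

theorem ae_hasDerivAt [CompleteSpace E] (h : IsPrimitive Ψ ψ) :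
    ∀ᵐ x, HasDerivAt Ψ (ψ x) x := by
  filter_upwards [LocallyIntegrable.ae_hasDerivAt_integral h.1] with x hx
  rw [h.eq_add_integral]
  exact (hx 0).const_add _

theorem integral (hψ : LocallyIntegrable ψ volume) (a : ℝ) :
    IsPrimitive (fun y => ∫ x in a..y, ψ x) ψ :=
  ⟨hψ, fun _ _ => intervalIntegral.integral_interval_sub_left
    (intervalIntegrable_of_locallyIntegrable hψ _ _)
    (intervalIntegrable_of_locallyIntegrable hψ _ _)⟩

theorem congr (h : IsPrimitive Ψ ψ) (he : ψ =ᵐ[volume] ψ') : IsPrimitive Ψ ψ' := by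
  refine ⟨fun x => ?_, fun a b => ?_⟩
  · obtain ⟨s, hs, hi⟩ := h.1 x
    exact ⟨s, hs, Integrable.congr hi (ae_restrict_of_ae he)⟩
  · rw [h.2 a b]
    exact intervalIntegral.integral_congr_ae (he.mono fun x hx _ => hx)

theorem add (h : IsPrimitive Ψ ψ) (h' : IsPrimitive Ψ' ψ') :
    IsPrimitive (fun x => Ψ x + Ψ' x) (fun x => ψ x + ψ' x) := by
  refine ⟨h.1.add h'.1, fun a b => ?_⟩
  rw [intervalIntegral.integral_add (h.intervalIntegrable a b) (h'.intervalIntegrable a b),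
    ← h.2, ← h'.2]
  exact add_sub_add_comm _ _ _ _

theorem clm_comp [CompleteSpace E] (h : IsPrimitive Ψ ψ) (L : E →L[ℂ] E) :
    IsPrimitive (fun x => L (Ψ x)) (fun x => L (ψ x)) := by
  refine ⟨fun x => ?_, fun a b => ?_⟩
  · obtain ⟨s, hs, hi⟩ := h.1 x
    exact ⟨s, hs, L.integrable_comp hi⟩
  · rw [← map_sub, h.2 a b, L.intervalIntegral_comp_comm (h.intervalIntegrable a b)]

/-- Increments of `Ψ` are dominated by those of the scalar primitive of `‖ψ‖`, which is absolutely
continuous. -/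
theorem absolutelyContinuousOnInterval (h : IsPrimitive Ψ ψ) (a b : ℝ) :
    AbsolutelyContinuousOnInterval Ψ a b := by
  have hi := h.intervalIntegrable
  have h1 := (hi a b).norm.absolutelyContinuousOnInterval_intervalIntegral
    (c := a) left_mem_uIcc
  refine squeeze_zero (fun _ => Finset.sum_nonneg fun _ _ => dist_nonneg) (fun I => ?_) h1
  refine Finset.sum_le_sum fun i _ => ?_
  rw [dist_comm, dist_eq_norm, h.2, dist_comm, Real.dist_eq,
    intervalIntegral.integral_interval_sub_left (hi _ _).norm (hi _ _).norm]
  exact intervalIntegral.norm_integral_le_abs_integral_norm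

/-- The product rule for a locally absolutely continuous function and a `C¹` factor. -/
theorem smul [CompleteSpace E] (h : IsPrimitive Ψ ψ) {c c' : ℝ → ℂ}
    (hc : ∀ x, HasDerivAt c (c' x) x) (hc' : Continuous c') :
    IsPrimitive (fun x => c x • Ψ x) (fun x => c' x • Ψ x + c x • ψ x) := by
  have hcc : Continuous c := continuous_iff_continuousAt.mpr fun x => (hc x).continuousAt
  have hloc : LocallyIntegrable (fun x => c' x • Ψ x + c x • ψ x) volume :=
    (hc'.smul h.continuous).locallyIntegrable.add (h.1.continuous_smul hcc)
  refine ⟨hloc, fun a b => ?_⟩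
  have hcd : ContDiff ℝ 1 c := by
    rw [contDiff_one_iff_deriv]
    refine ⟨fun x => (hc x).differentiableAt, ?_⟩
    rwa [show deriv c = c' from funext fun x => (hc x).deriv]
  have hp := IsPrimitive.integral hloc a
  have hac := ((hcd.contDiffOn (s := uIcc a b)).absolutelyContinuousOnInterval.smul
    (h.absolutelyContinuousOnInterval a b)).sub (hp.absolutelyContinuousOnInterval a b)
  -- The difference between `c • Ψ` and the primitive of its formal derivative is absolutely
  -- continuous with derivative zero almost everywhere, hence constant; its value at `a` identifies
  -- the constant.
  obtain ⟨C, hC⟩ := hac.const_of_ae_hasDerivAt_zero (by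
    filter_upwards [h.ae_hasDerivAt, hp.ae_hasDerivAt] with x hx hx' _
    have h3 := ((hc x).smul hx).sub hx'
    convert! h3 using 1
    abel)
  have ha := hC a left_mem_uIcc
  have hb := hC b right_mem_uIcc
  simp only [Pi.sub_apply, intervalIntegral.integral_same, sub_zero] at ha hb
  rw [← ha, sub_eq_iff_eq_add] at hb
  exact sub_eq_iff_eq_add.mpr (hb.trans (add_comm _ _))

end IsPrimitive

/-! ### Spectral decomposition of the free symbol -/

/-- The spectral projection of `symbol k ζ` onto its eigenvalue `i k`. -/
def spectralProj (ζ : ℂ) : Matrix (Fin 2) (Fin 2) ℂ := (1 / 2 : ℂ) • !![1, ζ; ζ⁻¹, 1]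

/-- The matrix `i σ₁ (z - m σ₃)` in terms of `k = √(z² - m²)` and `ζ = (z + m) / k`. -/
def symbol (k ζ : ℂ) : Matrix (Fin 2) (Fin 2) ℂ := (Complex.I * k) • !![0, ζ; ζ⁻¹, 0]

/-- This symmetry exchanges the two eigenvalues, so each identity for `-ik` follows from the one for
`ik`. -/
theorem symbol_neg_neg (k ζ : ℂ) : symbol (-k) (-ζ) = symbol k ζ := by
  ext i j
  fin_cases i <;> fin_cases j <;> simp [symbol, inv_neg]

theorem symbol_mul_spectralProj (k : ℂ) {ζ : ℂ} (hζ : ζ ≠ 0) :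
    symbol k ζ * spectralProj ζ = (Complex.I * k) • spectralProj ζ := by
  ext i j
  fin_cases i <;> fin_cases j <;>
    simp [symbol, spectralProj, Matrix.mul_apply, Fin.sum_univ_two] <;> field_simp

theorem spectralProj_mul_symbol (k : ℂ) {ζ : ℂ} (hζ : ζ ≠ 0) :
    spectralProj ζ * symbol k ζ = (Complex.I * k) • spectralProj ζ := by
  ext i j
  fin_cases i <;> fin_cases j <;>
    simp [symbol, spectralProj, Matrix.mul_apply, Fin.sum_univ_two] <;> field_simp

theorem symbol_mul_spectralProj_neg (k : ℂ) {ζ : ℂ} (hζ : ζ ≠ 0) :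
    symbol k ζ * spectralProj (-ζ) = -(Complex.I * k) • spectralProj (-ζ) := by
  rw [← symbol_neg_neg, symbol_mul_spectralProj _ (neg_ne_zero.mpr hζ), mul_neg]

theorem spectralProj_neg_mul_symbol (k : ℂ) {ζ : ℂ} (hζ : ζ ≠ 0) :
    spectralProj (-ζ) * symbol k ζ = -(Complex.I * k) • spectralProj (-ζ) := by
  rw [← symbol_neg_neg, spectralProj_mul_symbol _ (neg_ne_zero.mpr hζ), mul_neg]

theorem spectralProj_add_neg (ζ : ℂ) : spectralProj ζ + spectralProj (-ζ) = 1 := by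
  ext i j
  fin_cases i <;> fin_cases j <;> simp [spectralProj, inv_neg] <;> norm_num

theorem sigma1_mul_self : sigma1 * sigma1 = 1 := by
  ext i j
  fin_cases i <;> fin_cases j <;> simp [sigma1, Matrix.mul_apply, Fin.sum_univ_two]

theorem symbol_eq (m : ℝ) (z k ζ : ℂ) (h1 : k * ζ = z + m) (h2 : k * ζ⁻¹ = z - m) :
    symbol k ζ = Complex.I • (sigma1 * (z • (1 : Matrix (Fin 2) (Fin 2) ℂ)
      - (m : ℂ) • sigma3)) := by
  ext i j
  fin_cases i <;> fin_cases j <;>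
    simp [symbol, sigma1, sigma3, Matrix.vecMul, dotProduct, Fin.sum_univ_two, mul_assoc, h1, h2]

/-- The matrix has rank one: both components of the image of `v` are multiples of `v 0 + ζ * v 1`.
Cauchy–Schwarz for this functional gives the bound, since `η(s)² = (1 + s⁻¹)(1 + s)/4`. -/
theorem norm_act_spectralProj_le {ζ : ℂ} (hζ : ζ ≠ 0) :
    ‖act (spectralProj ζ)‖ ≤ eta (‖ζ‖ ^ 2) := by
  refine ContinuousLinearMap.opNorm_le_bound _ (Real.sqrt_nonneg _) fun v => ?_
  have hz : 0 < ‖ζ‖ := norm_pos_iff.mpr hζ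
  have e : ‖act (spectralProj ζ) v‖ ^ 2
      = (1 / 4) * (1 + (‖ζ‖ ^ 2)⁻¹) * ‖v 0 + ζ * v 1‖ ^ 2 := by
    have h0 : (act (spectralProj ζ) v) 0 = (1 / 2) * (v 0 + ζ * v 1) := by
      simp [spectralProj, Matrix.mulVec, dotProduct, Fin.sum_univ_two]
      ring
    have h1 : (act (spectralProj ζ) v) 1 = (1 / 2) * ζ⁻¹ * (v 0 + ζ * v 1) := by
      simp [spectralProj, Matrix.mulVec, dotProduct, Fin.sum_univ_two]
      field_simp
    rw [EuclideanSpace.norm_sq_eq, Fin.sum_univ_two, h0, h1]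
    simp only [norm_mul, norm_inv, norm_div, norm_one, RCLike.norm_ofNat]
    field_simp
    ring
  have e2 : ‖v 0 + ζ * v 1‖ ^ 2 ≤ (1 + ‖ζ‖ ^ 2) * ‖v‖ ^ 2 := by
    have h := norm_add_le (v 0) (ζ * v 1)
    rw [norm_mul] at h
    rw [EuclideanSpace.norm_sq_eq, Fin.sum_univ_two]
    have h3 := pow_le_pow_left₀ (norm_nonneg _) h 2
    nlinarith [sq_nonneg (‖ζ‖ * ‖v 0‖ - ‖v 1‖)]
  have e3 : eta (‖ζ‖ ^ 2) ^ 2 = (1 / 4) * (1 + (‖ζ‖ ^ 2)⁻¹) * (1 + ‖ζ‖ ^ 2) := by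
    rw [eta, Real.sq_sqrt (by positivity)]
    field_simp
    ring
  refine (sq_le_sq₀ (norm_nonneg _) (mul_nonneg (Real.sqrt_nonneg _) (norm_nonneg _))).mp ?_
  change _ ≤ (eta _ * _) ^ 2
  rw [e, mul_pow, e3, mul_assoc _ (1 + ‖ζ‖ ^ 2)]
  exact mul_le_mul_of_nonneg_left e2 (by positivity)

theorem norm_act_sigma1_le : ‖act sigma1‖ ≤ 1 := by
  refine ContinuousLinearMap.opNorm_le_bound _ zero_le_one fun v => ?_
  rw [one_mul]
  refine (sq_le_sq₀ (norm_nonneg _) (norm_nonneg _)).mp ?_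
  rw [EuclideanSpace.norm_sq_eq, EuclideanSpace.norm_sq_eq, Fin.sum_univ_two, Fin.sum_univ_two]
  simp [sigma1, Matrix.mulVec, dotProduct, Fin.sum_univ_two, add_comm]

theorem norm_act_spectralProj_mul_sigma1_le {ζ : ℂ} (hζ : ζ ≠ 0) :
    ‖act (spectralProj ζ * sigma1)‖ ≤ eta (‖ζ‖ ^ 2) := by
  have h : act (spectralProj ζ * sigma1) = act (spectralProj ζ) * act sigma1 := map_mul _ _ _
  rw [h]
  calc _ ≤ ‖act (spectralProj ζ)‖ * ‖act sigma1‖ := norm_mul_le _ _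
    _ ≤ eta (‖ζ‖ ^ 2) * 1 := mul_le_mul (norm_act_spectralProj_le hζ) norm_act_sigma1_le
        (norm_nonneg _) (Real.sqrt_nonneg _)
    _ = _ := mul_one _

theorem waveNumber_sq (m : ℝ) (z : ℂ) : waveNumber m z ^ 2 = z ^ 2 - (m : ℂ) ^ 2 := sqrtUp_sq _

theorem waveNumber_im_pos {m : ℝ} {z : ℂ} (hz : ∀ t : ℝ, t ≤ -m ∨ m ≤ t → z ≠ (t : ℂ)) :
    0 < (waveNumber m z).im := by
  refine sqrtUp_im_pos fun t ht h => ?_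
  have h1 : z ^ 2 = ((t + m ^ 2 : ℝ) : ℂ) := by
    push_cast
    rw [← h]
    ring
  have hs : (z - (Real.sqrt (t + m ^ 2) : ℝ)) * (z + (Real.sqrt (t + m ^ 2) : ℝ)) = 0 := by
    have h2 : ((Real.sqrt (t + m ^ 2) : ℝ) : ℂ) ^ 2 = ((t + m ^ 2 : ℝ) : ℂ) := by
      rw [← Complex.ofReal_pow, Real.sq_sqrt (by positivity)]
    linear_combination h1 - h2
  -- If `z² - m² = t ≥ 0`, then `z = ±√(t + m²)` is real and lies on one of the two excluded rays.
  have hm : m ≤ Real.sqrt (t + m ^ 2) := Real.le_sqrt_of_sq_le (by linarith)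
  rcases mul_eq_zero.mp hs with h3 | h3
  · exact hz _ (Or.inr hm) (sub_eq_zero.mp h3)
  · refine hz (-Real.sqrt (t + m ^ 2)) (Or.inl (by linarith)) ?_
    rw [eq_neg_of_add_eq_zero_left h3]
    push_cast
    rfl

/-- The parameter `ζ = (z + m) / k` with `ζ² = Φ(z)`. -/
theorem exists_parameter {m : ℝ} {z : ℂ} (hz : ∀ t : ℝ, t ≤ -m ∨ m ≤ t → z ≠ (t : ℂ)) :
    ∃ ζ : ℂ, ζ ≠ 0 ∧ waveNumber m z * ζ = z + m ∧ waveNumber m z * ζ⁻¹ = z - m ∧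
      ‖ζ‖ ^ 2 = ‖Phi m z‖ := by
  have hk : waveNumber m z ≠ 0 := by
    intro h
    have := waveNumber_im_pos hz
    simp [h] at this
  have h1 : z - m ≠ 0 := sub_ne_zero.mpr (hz m (Or.inr le_rfl))
  have h2 : z + m ≠ 0 := by
    intro h
    refine hz (-m) (Or.inl le_rfl) ?_
    rw [eq_neg_of_add_eq_zero_left h]
    push_cast
    rfl
  have hsq := waveNumber_sq m z
  refine ⟨(z + m) / waveNumber m z, div_ne_zero h2 hk, by field_simp, ?_, ?_⟩
  · field_simp
    linear_combination hsq
  · rw [← norm_pow, Phi]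
    congr 1
    rw [div_pow, div_eq_div_iff (pow_ne_zero _ hk) h1]
    linear_combination -(z + m) * hsq

/-! ### The free Green kernel and the first order system -/

section Kernel

variable {E : Type*} [NormedAddCommGroup E] [NormedSpace ℂ E]

theorem hasDerivAt_cexp_mul (c : ℂ) (x : ℝ) :
    HasDerivAt (fun x : ℝ => Complex.exp (c * x)) (c * Complex.exp (c * x)) x := by
  have h : HasDerivAt (fun x : ℝ => c * (x : ℂ)) (c * 1) x :=
    (Complex.ofRealCLM.hasDerivAt (x := x)).const_mul c
  simpa [mul_comm] using h.cexp

theorem hasDerivAt_cexp_mul_sub (c : ℂ) (x₀ x : ℝ) :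
    HasDerivAt (fun x : ℝ => Complex.exp (c * (x - x₀ : ℝ)))
      (c * Complex.exp (c * (x - x₀ : ℝ))) x :=
  (hasDerivAt_cexp_mul c (x - x₀)).comp_sub_const x x₀

theorem norm_cexp_I_mul (k : ℂ) (x : ℝ) :
    ‖Complex.exp (Complex.I * k * x)‖ = Real.exp (-(k.im * x)) := by
  rw [Complex.norm_exp]
  simp

/-- The kernel `e^{ik|x-y|} (A if y ≤ x, B if x < y)`. -/
def kernel (k : ℂ) (A B : E →L[ℂ] E) (x y : ℝ) : E →L[ℂ] E :=
  Complex.exp (Complex.I * k * (|x - y| : ℝ)) • (if y ≤ x then A else B)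

theorem norm_kernel_le {k : ℂ} {A B : E →L[ℂ] E} {C : ℝ} (hA : ‖A‖ ≤ C) (hB : ‖B‖ ≤ C)
    (x y : ℝ) : ‖kernel k A B x y‖ ≤ C * Real.exp (-(k.im * |x - y|)) := by
  rw [kernel, norm_smul, norm_cexp_I_mul, mul_comm]
  refine mul_le_mul_of_nonneg_right ?_ (Real.exp_nonneg _)
  split_ifs <;> assumption

theorem stronglyMeasurable_kernel (k : ℂ) (A B : E →L[ℂ] E) :
    StronglyMeasurable (fun q : ℝ × ℝ => kernel k A B q.1 q.2) := by
  unfold kernel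
  refine StronglyMeasurable.smul (f := fun q : ℝ × ℝ =>
    Complex.exp (Complex.I * k * (|q.1 - q.2| : ℝ))) (Continuous.stronglyMeasurable (by fun_prop)) ?_
  exact StronglyMeasurable.ite (measurableSet_le measurable_snd measurable_fst)
    stronglyMeasurable_const stronglyMeasurable_const

theorem kernel_of_le {k : ℂ} {A B : E →L[ℂ] E} {x y : ℝ} (h : y ≤ x) (v : E) :
    kernel k A B x y v
      = Complex.exp (Complex.I * k * x) • A (Complex.exp (-(Complex.I * k) * y) • v) := by
  rw [kernel, if_pos h, abs_of_nonneg (sub_nonneg.mpr h), map_smul, smul_smul, ← Complex.exp_add,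
    smul_apply]
  congr 2
  push_cast
  ring

theorem kernel_of_lt {k : ℂ} {A B : E →L[ℂ] E} {x y : ℝ} (h : x < y) (v : E) :
    kernel k A B x y v
      = Complex.exp (-(Complex.I * k) * x) • B (Complex.exp (Complex.I * k * y) • v) := by
  rw [kernel, if_neg (not_le.mpr h), abs_of_neg (sub_neg.mpr h), map_smul, smul_smul,
    ← Complex.exp_add, smul_apply]
  congr 2
  push_cast
  ring

theorem locallyIntegrable_of_exp {κ : ℝ} {ψ : ℝ → E}
    (hψ : Integrable (fun y => Real.exp (-(κ * |y|)) • ψ y)) : LocallyIntegrable ψ volume := by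
  have h := hψ.locallyIntegrable.continuous_smul (g := fun y : ℝ => Real.exp (κ * |y|))
    (by fun_prop)
  convert! h using 1
  funext y
  simp [smul_smul, ← Real.exp_add]

theorem integrableOn_cexp_smul {c : ℂ} {κ : ℝ} {ψ : ℝ → E}
    (hψ : Integrable (fun y => Real.exp (-(κ * |y|)) • ψ y)) {s : Set ℝ} (hs : MeasurableSet s)
    {C : ℝ} (hC : ∀ y ∈ s, c.re * y ≤ C - κ * |y|) :
    IntegrableOn (fun y : ℝ => Complex.exp (c * y) • ψ y) s := by
  have hm : AEStronglyMeasurable (fun y : ℝ => Complex.exp (c * y) • ψ y) volume :=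
    ((locallyIntegrable_of_exp hψ).continuous_smul
      (g := fun y : ℝ => Complex.exp (c * y)) (by fun_prop)).aestronglyMeasurable
  refine Integrable.mono' ((hψ.norm.const_mul (Real.exp C)).integrableOn (s := s)) hm.restrict ?_
  refine (ae_restrict_iff' hs).mpr (Eventually.of_forall fun y hy => ?_)
  rw [norm_smul, norm_smul, Complex.norm_exp, Real.norm_of_nonneg (Real.exp_nonneg _),
    ← mul_assoc, ← Real.exp_add]
  refine mul_le_mul_of_nonneg_right (Real.exp_le_exp.mpr ?_) (norm_nonneg _)
  have := hC y hy
  simpa [sub_eq_add_neg] using this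

theorem integrableOn_Iic_cexp {k : ℂ} (hk : 0 ≤ k.im) {ψ : ℝ → E}
    (hψ : Integrable (fun y => Real.exp (-(k.im * |y|)) • ψ y)) (x : ℝ) :
    IntegrableOn (fun y : ℝ => Complex.exp (-(Complex.I * k) * y) • ψ y) (Iic x) := by
  -- For `y ≤ x` one has `y + |y| ≤ 2|x|`, so the growing exponential is at most a constant times
  -- `e^{-κ|y|}`.
  refine integrableOn_cexp_smul hψ measurableSet_Iic (C := 2 * k.im * |x|) fun y hy => ?_
  simp only [Complex.neg_re, Complex.mul_re, Complex.I_re, Complex.I_im, zero_mul, one_mul,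
    zero_sub, neg_neg]
  have hy : y ≤ x := hy
  have : y + |y| ≤ 2 * |x| := by
    rcases abs_cases y with h | h <;> rcases abs_cases x with h' | h' <;> linarith
  nlinarith

theorem integrableOn_Ioi_cexp {k : ℂ} (hk : 0 ≤ k.im) {ψ : ℝ → E}
    (hψ : Integrable (fun y => Real.exp (-(k.im * |y|)) • ψ y)) (x : ℝ) :
    IntegrableOn (fun y : ℝ => Complex.exp (Complex.I * k * y) • ψ y) (Ioi x) := by
  refine integrableOn_cexp_smul hψ measurableSet_Ioi (C := 2 * k.im * |x|) fun y hy => ?_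
  simp only [Complex.mul_re, Complex.I_re, Complex.I_im, zero_mul, one_mul,
    zero_sub]
  have hy : x < y := hy
  have : -y + |y| ≤ 2 * |x| := by
    rcases abs_cases y with h | h <;> rcases abs_cases x with h' | h' <;> linarith
  nlinarith

/-- On each side of `y = x` the exponential splits into a factor in `x` and a factor in `y`. This
leaves primitives in `x`, to which the product rule applies. -/
theorem integral_kernel_eq [CompleteSpace E] {k : ℂ} (hk : 0 ≤ k.im) (A B : E →L[ℂ] E) {ψ : ℝ → E}
    (hψ : Integrable (fun y => Real.exp (-(k.im * |y|)) • ψ y)) (x : ℝ) :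
    ∫ y, kernel k A B x y (ψ y)
      = A (Complex.exp (Complex.I * k * x) •
          ∫ y in Iic x, Complex.exp (-(Complex.I * k) * y) • ψ y)
        + B (Complex.exp (-(Complex.I * k) * x) •
          ∫ y in Ioi x, Complex.exp (Complex.I * k * y) • ψ y) := by
  have h1 := integrableOn_Iic_cexp hk hψ x
  have h2 := integrableOn_Ioi_cexp hk hψ x
  have e1 : EqOn (fun y => kernel k A B x y (ψ y)) (fun y => Complex.exp (Complex.I * k * x) •
      A (Complex.exp (-(Complex.I * k) * y) • ψ y)) (Iic x) := fun y hy => kernel_of_le hy _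
  have e2 : EqOn (fun y => kernel k A B x y (ψ y)) (fun y => Complex.exp (-(Complex.I * k) * x) •
      B (Complex.exp (Complex.I * k * y) • ψ y)) (Ioi x) := fun y hy => kernel_of_lt hy _
  have i1 : IntegrableOn (fun y => kernel k A B x y (ψ y)) (Iic x) :=
    IntegrableOn.congr_fun (Integrable.smul _ (A.integrable_comp h1)) e1.symm measurableSet_Iic
  have i2 : IntegrableOn (fun y => kernel k A B x y (ψ y)) (Ioi x) :=
    IntegrableOn.congr_fun (Integrable.smul _ (B.integrable_comp h2)) e2.symm measurableSet_Ioi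
  rw [← setIntegral_univ, ← Iic_union_Ioi (a := x),
    setIntegral_union (Iic_disjoint_Ioi le_rfl) measurableSet_Ioi i1 i2,
    setIntegral_congr_fun measurableSet_Iic e1, setIntegral_congr_fun measurableSet_Ioi e2,
    integral_smul, integral_smul, A.integral_comp_comm h1, B.integral_comp_comm h2,
    map_smul, map_smul]

/-- The kernel inverts the first order system `F' = M F + J ψ`. -/
theorem isPrimitive_integral_kernel [CompleteSpace E] {k : ℂ} (hk : 0 ≤ k.im) {A B M J : E →L[ℂ] E}
    (hA : M * A = (Complex.I * k) • A) (hB : M * B = -(Complex.I * k) • B) (hJ : A - B = J)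
    {ψ : ℝ → E} (hψ : Integrable (fun y => Real.exp (-(k.im * |y|)) • ψ y)) :
    IsPrimitive (fun x => ∫ y, kernel k A B x y (ψ y))
      (fun x => M (∫ y, kernel k A B x y (ψ y)) + J (ψ x)) := by
  have hl := locallyIntegrable_of_exp hψ
  have p1 : IsPrimitive (fun x : ℝ => ∫ y in Iic x, Complex.exp (-(Complex.I * k) * y) • ψ y)
      (fun y : ℝ => Complex.exp (-(Complex.I * k) * y) • ψ y) := by
    refine ⟨hl.continuous_smul (by fun_prop), fun a b => ?_⟩
    exact intervalIntegral.integral_Iic_sub_Iic (integrableOn_Iic_cexp hk hψ a)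
      (integrableOn_Iic_cexp hk hψ b)
  have p2 : IsPrimitive (fun x : ℝ => ∫ y in Ioi x, Complex.exp (Complex.I * k * y) • ψ y)
      (fun y : ℝ => -(Complex.exp (Complex.I * k * y) • ψ y)) := by
    refine ⟨(hl.continuous_smul (g := fun y : ℝ => Complex.exp (Complex.I * k * y))
      (by fun_prop)).neg, fun a b => ?_⟩
    rw [intervalIntegral.integral_neg, ← intervalIntegral.integral_Ioi_sub_Ioi'
      (integrableOn_Ioi_cexp hk hψ a) (integrableOn_Ioi_cexp hk hψ b)]
    abel
  have q1 := (p1.smul (hasDerivAt_cexp_mul (Complex.I * k)) (by fun_prop)).clm_comp A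
  have q2 := (p2.smul (hasDerivAt_cexp_mul (-(Complex.I * k))) (by fun_prop)).clm_comp B
  have q := q1.add q2
  have hA' (v : E) : M (A v) = (Complex.I * k) • A v := DFunLike.congr_fun hA v
  have hB' (v : E) : M (B v) = -(Complex.I * k) • B v := DFunLike.congr_fun hB v
  simp_rw [integral_kernel_eq hk A B hψ]
  refine q.congr (Eventually.of_forall fun x => ?_)
  simp only [map_add, hA', hB', ← hJ, map_smul, smul_neg, map_neg, smul_smul,
    sub_apply]
  -- Differentiating the limits of integration produces `A ψ - B ψ`, the jump of the kernel on the
  -- diagonal, once the two exponentials cancel.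
  have e1 : Complex.exp (Complex.I * k * x) * Complex.exp (-(Complex.I * k) * x) = 1 := by
    rw [← Complex.exp_add]
    simp
  rw [mul_comm (Complex.exp (-(Complex.I * k) * x)), e1]
  module

/-- A priori estimate on a bounded interval for solutions of `F' = M F + J ψ`. -/
theorem norm_le_of_isPrimitive [CompleteSpace E] {k : ℂ} (hk : 0 ≤ k.im) {P Q M J : E →L[ℂ] E} {C : ℝ}
    (hP : P * M = (Complex.I * k) • P) (hQ : Q * M = -(Complex.I * k) • Q) (hPQ : P + Q = 1)
    (hPJ : ‖P * J‖ ≤ C) (hQJ : ‖Q * J‖ ≤ C)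
    {F ψ : ℝ → E} (hF : IsPrimitive F (fun x => M (F x) + J (ψ x))) (hψ : LocallyIntegrable ψ volume)
    {a b x : ℝ} (hx : x ∈ Icc a b) :
    ‖F x‖ ≤ ‖P‖ * ‖F a‖ + ‖Q‖ * ‖F b‖
      + ∫ y in a..b, C * (Real.exp (-(k.im * |x - y|)) * ‖ψ y‖) := by
  have hP' (v : E) : P (M v) = (Complex.I * k) • P v := DFunLike.congr_fun hP v
  have hQ' (v : E) : Q (M v) = -(Complex.I * k) • Q v := DFunLike.congr_fun hQ v
  -- The `P` component is integrated from `a` to `x` and the `Q` component from `x` to `b`, with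
  -- integrating factors equal to `1` at `x`. With this choice both exponentials decay away from
  -- `x`.
  have q1 := ((hF.smul (hasDerivAt_cexp_mul_sub (-(Complex.I * k)) x) (by fun_prop)).clm_comp P).2
    a x
  have q2 := ((hF.smul (hasDerivAt_cexp_mul_sub (Complex.I * k) x) (by fun_prop)).clm_comp Q).2 x b
  have hx0 : F x = P (F x) + Q (F x) := (DFunLike.congr_fun hPQ (F x)).symm
  have hg : LocallyIntegrable (fun y => C * (Real.exp (-(k.im * |x - y|)) * ‖ψ y‖)) volume := by
    have hn : LocallyIntegrable (fun y => ‖ψ y‖) volume := fun x =>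
      let ⟨s, hs, hi⟩ := hψ x
      ⟨s, hs, Integrable.norm hi⟩
    have h := hn.continuous_smul (g := fun y : ℝ => C * Real.exp (-(k.im * |x - y|)))
      (by fun_prop)
    simpa only [smul_eq_mul, mul_assoc] using h
  have hgi := intervalIntegrable_of_locallyIntegrable hg
  have n1 : ‖P (F x)‖ ≤ ‖P‖ * ‖F a‖ + ∫ y in a..x, C * (Real.exp (-(k.im * |x - y|)) * ‖ψ y‖) := by
    simp only [sub_self, Complex.ofReal_zero, mul_zero, Complex.exp_zero, one_smul] at q1
    rw [sub_eq_iff_eq_add'.mp q1, map_smul]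
    refine (norm_add_le _ _).trans (add_le_add ?_ ?_)
    · rw [norm_smul, neg_mul, ← mul_neg, ← Complex.ofReal_neg, norm_cexp_I_mul]
      refine (mul_le_of_le_one_left (norm_nonneg _) ?_).trans (P.le_opNorm _)
      rw [Real.exp_le_one_iff]
      nlinarith [mul_nonneg hk (sub_nonneg.mpr hx.1)]
    · refine intervalIntegral.norm_integral_le_of_norm_le hx.1
        (Eventually.of_forall fun y hy => ?_) (hgi a x)
      have e : P ((-(Complex.I * k) * Complex.exp (-(Complex.I * k) * (y - x : ℝ))) • F y
          + Complex.exp (-(Complex.I * k) * (y - x : ℝ)) • (M (F y) + J (ψ y)))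
          = Complex.exp (Complex.I * k * (x - y : ℝ)) • (P * J) (ψ y) := by
        rw [show (-(Complex.I * k) * (y - x : ℝ)) = Complex.I * k * (x - y : ℝ) by push_cast; ring]
        simp only [map_add, map_smul, hP', mul_apply_eq_comp]
        module
      rw [e, norm_smul, norm_cexp_I_mul, abs_of_nonneg (sub_nonneg.mpr hy.2), mul_left_comm]
      exact mul_le_mul_of_nonneg_left ((P * J).le_of_opNorm_le hPJ _) (Real.exp_nonneg _)
  have n2 : ‖Q (F x)‖ ≤ ‖Q‖ * ‖F b‖ + ∫ y in x..b, C * (Real.exp (-(k.im * |x - y|)) * ‖ψ y‖) := by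
    simp only [sub_self, Complex.ofReal_zero, mul_zero, Complex.exp_zero, one_smul] at q2
    rw [← sub_eq_iff_eq_add.mpr (sub_eq_iff_eq_add'.mp q2), map_smul]
    refine (norm_sub_le _ _).trans (add_le_add ?_ ?_)
    · rw [norm_smul, norm_cexp_I_mul]
      refine (mul_le_of_le_one_left (norm_nonneg _) ?_).trans (Q.le_opNorm _)
      rw [Real.exp_le_one_iff]
      nlinarith [mul_nonneg hk (sub_nonneg.mpr hx.2)]
    · refine intervalIntegral.norm_integral_le_of_norm_le hx.2
        (Eventually.of_forall fun y hy => ?_) (hgi x b)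
      have e : Q ((Complex.I * k * Complex.exp (Complex.I * k * (y - x : ℝ))) • F y
          + Complex.exp (Complex.I * k * (y - x : ℝ)) • (M (F y) + J (ψ y)))
          = Complex.exp (Complex.I * k * (y - x : ℝ)) • (Q * J) (ψ y) := by
        simp only [map_add, map_smul, hQ', mul_apply_eq_comp]
        module
      rw [e, norm_smul, norm_cexp_I_mul, abs_of_neg (sub_neg.mpr hy.1), neg_sub, mul_left_comm]
      exact mul_le_mul_of_nonneg_left ((Q * J).le_of_opNorm_le hQJ _) (Real.exp_nonneg _)
  rw [← intervalIntegral.integral_add_adjacent_intervals (hgi a x) (hgi x b)]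
  calc ‖F x‖ ≤ ‖P (F x)‖ + ‖Q (F x)‖ := by
        conv_lhs => rw [hx0]
        exact norm_add_le _ _
    _ ≤ _ := by linarith

end Kernel

/-! ### Exponential weights and Hölder's inequality -/

theorem integrable_exp_neg_mul_abs {c : ℝ} (hc : 0 < c) :
    Integrable (fun x : ℝ => Real.exp (-(c * |x|))) ∧
      ∫ x : ℝ, Real.exp (-(c * |x|)) = 2 / c := by
  have h : ∫ x : ℝ, Real.exp (-(c * |x|)) = 2 / c := by
    have h1 := integral_comp_abs (f := fun x => Real.exp (-(c * x)))
    rw [h1]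
    have h2 := integral_exp_mul_Ioi (a := -c) (by linarith) 0
    simp only [neg_mul, mul_zero, Real.exp_zero] at h2
    rw [h2]
    field_simp
  -- A non-integrable function has integral `0` by convention, so the nonzero value `2 / c` already
  -- proves integrability.
  refine ⟨Integrable.of_integral_ne_zero ?_, h⟩
  rw [h]
  positivity

theorem integrable_exp_neg_mul_abs_sub {c : ℝ} (hc : 0 < c) (x : ℝ) :
    Integrable (fun y : ℝ => Real.exp (-(c * |x - y|))) ∧
      ∫ y : ℝ, Real.exp (-(c * |x - y|)) = 2 / c := by
  obtain ⟨h1, h2⟩ := integrable_exp_neg_mul_abs hc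
  refine ⟨h1.comp_sub_left x, ?_⟩
  rw [← h2]
  exact integral_sub_left_eq_self (fun t => Real.exp (-(c * |t|))) volume x

/-- Hölder's inequality for the convolution with an exponential. -/
theorem integral_exp_mul_le {p κ : ℝ} (hp : 1 < p) (hκ : 0 < κ) {w : ℝ → ℝ} (hw0 : ∀ y, 0 ≤ w y)
    (hw : MemLp w (ENNReal.ofReal p) volume) (x : ℝ) :
    Integrable (fun y => Real.exp (-(κ * |x - y|)) * w y) ∧
    ∫ y, Real.exp (-(κ * |x - y|)) * w y
      ≤ (2 * (p - 1) / p) ^ ((p - 1) / p) * κ ^ (-((p - 1) / p)) * (∫ y, w y ^ p) ^ (1 / p) := by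
  have hpq : (p / (p - 1)).HolderConjugate p := by
    rw [Real.holderConjugate_iff]
    have : 0 < p - 1 := by linarith
    refine ⟨by rw [lt_div_iff₀ this]; linarith, ?_⟩
    field_simp
    ring
  set q := p / (p - 1) with hq
  have hq0 : 0 < q := hpq.pos
  have he (y : ℝ) : Real.exp (-(κ * |x - y|)) ^ q = Real.exp (-(q * κ * |x - y|)) := by
    rw [← Real.exp_mul]
    congr 1
    ring
  obtain ⟨hi, hv⟩ := integrable_exp_neg_mul_abs_sub (mul_pos hq0 hκ) x
  have hm : MemLp (fun y : ℝ => Real.exp (-(κ * |x - y|))) (ENNReal.ofReal q) volume := by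
    have hc : Continuous (fun y : ℝ => Real.exp (-(κ * |x - y|))) := by fun_prop
    rw [← integrable_norm_rpow_iff hc.aestronglyMeasurable (by simpa using hq0)
      ENNReal.ofReal_ne_top, ENNReal.toReal_ofReal hq0.le]
    simpa only [Real.norm_of_nonneg (Real.exp_nonneg _), he] using hi
  have : (ENNReal.ofReal q).HolderConjugate (ENNReal.ofReal p) := hpq.ennrealOfReal
  refine ⟨hm.integrable_mul hw, ?_⟩
  refine (integral_mul_le_Lp_mul_Lq_of_nonneg hpq (Eventually.of_forall fun y => Real.exp_nonneg _)
    (Eventually.of_forall hw0) hm hw).trans (le_of_eq ?_)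
  simp only [he]
  rw [hv]
  congr 1
  have hp0 : 0 < p := by linarith
  have hp1 : 0 < p - 1 := by linarith
  -- The `L^q` norm of the exponential is `(2 / (qκ))^{1/q}`; substituting `q = p / (p - 1)` gives
  -- the constant of the theorem.
  rw [show 1 / q = (p - 1) / p by rw [hq]; field_simp,
    show 2 / (q * κ) = (2 * (p - 1) / p) * κ⁻¹ by rw [hq]; field_simp,
    Real.mul_rpow (by positivity) (by positivity), Real.inv_rpow hκ.le, Real.rpow_neg hκ.le]

/-! ### Schur test with an exponential weight -/

theorem sq_lintegral_mul_le {α : Type*} [MeasurableSpace α] {μ : Measure α} {f g : α → ℝ≥0∞}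
    (hf : AEMeasurable f μ) (hg : AEMeasurable g μ) :
    (∫⁻ a, f a * g a ∂μ) ^ 2 ≤ (∫⁻ a, f a ^ 2 ∂μ) * ∫⁻ a, g a ^ 2 ∂μ := by
  have h := ENNReal.lintegral_mul_le_Lp_mul_Lq μ (p := 2) (q := 2) Real.HolderConjugate.two_two hf hg
  have h2 := pow_le_pow_left₀ zero_le h 2
  have hr (t : ℝ≥0∞) : (t ^ (1 / 2 : ℝ)) ^ 2 = t := by
    rw [← ENNReal.rpow_natCast, ← ENNReal.rpow_mul]
    norm_num
  simp only [mul_pow, hr, ENNReal.rpow_ofNat, Pi.mul_apply] at h2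
  exact h2

theorem eLpNorm_two_le_of_lintegral_sq_le {α E F : Type*} [MeasurableSpace α] {μ : Measure α}
    [NormedAddCommGroup E] [NormedAddCommGroup F] {f : α → E} {g : α → F} {c : ℝ≥0∞}
    (h : ∫⁻ a, ‖f a‖ₑ ^ 2 ∂μ ≤ c ^ 2 * ∫⁻ a, ‖g a‖ₑ ^ 2 ∂μ) :
    eLpNorm f 2 μ ≤ c * eLpNorm g 2 μ := by
  rw [eLpNorm_eq_lintegral_rpow_enorm_toReal two_ne_zero ENNReal.ofNat_ne_top,
    eLpNorm_eq_lintegral_rpow_enorm_toReal two_ne_zero ENNReal.ofNat_ne_top]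
  simp only [ENNReal.toReal_ofNat, ENNReal.rpow_ofNat]
  refine (ENNReal.rpow_le_rpow h (by norm_num)).trans (le_of_eq ?_)
  rw [ENNReal.mul_rpow_of_nonneg _ _ (by norm_num)]
  congr 1
  rw [← ENNReal.rpow_natCast, ← ENNReal.rpow_mul]
  norm_num

theorem lintegral_enorm_sq_lt_top {α E : Type*} [MeasurableSpace α] {μ : Measure α}
    [NormedAddCommGroup E] {f : α → E} (hf : MemLp f 2 μ) : ∫⁻ a, ‖f a‖ₑ ^ 2 ∂μ < ∞ := by
  have h := lintegral_rpow_enorm_lt_top_of_eLpNorm_lt_top two_ne_zero ENNReal.ofNat_ne_top hf.2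
  simpa using h

/-- The Schur-type condition `∫ e^{-κ|x-y|} ‖b(y)‖² dy ≤ Θ` for all `x`. -/
structure SchurBound {X : Type*} [NormedAddCommGroup X] (κ : ℝ) (b : ℝ → X) (Θ : ℝ) : Prop where
  meas : AEStronglyMeasurable b volume
  bound : ∀ x, ∫⁻ y, ENNReal.ofReal (Real.exp (-(κ * |x - y|))) * ‖b y‖ₑ ^ 2 ≤ ENNReal.ofReal Θ

namespace SchurBound

theorem of_integral {X : Type*} [NormedAddCommGroup X] {κ Θ : ℝ} {b : ℝ → X}
    (hm : AEStronglyMeasurable b volume)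
    (hi : ∀ x, Integrable (fun y => Real.exp (-(κ * |x - y|)) * ‖b y‖ ^ 2))
    (hb : ∀ x, ∫ y, Real.exp (-(κ * |x - y|)) * ‖b y‖ ^ 2 ≤ Θ) : SchurBound κ b Θ := by
  refine ⟨hm, fun x => ?_⟩
  refine le_trans (le_of_eq ?_) (ENNReal.ofReal_le_ofReal (hb x))
  rw [ofReal_integral_eq_lintegral_ofReal (hi x)
    (Eventually.of_forall fun y => mul_nonneg (Real.exp_nonneg _) (sq_nonneg _))]
  refine lintegral_congr fun y => ?_
  rw [ENNReal.ofReal_mul (Real.exp_nonneg _), ENNReal.ofReal_pow (norm_nonneg _), ofReal_norm]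

variable {X Y E : Type*} [NormedAddCommGroup X] [NormedAddCommGroup Y] [NormedAddCommGroup E]
  {κ Θ Θ' : ℝ} {b : ℝ → X} {a : ℝ → Y} {f : ℝ → E}

/-- Cauchy–Schwarz after splitting the weight into two equal square roots, one grouped with `b` and
one with `f`. -/
theorem sq_lintegral_le (hb : SchurBound κ b Θ) (hf : AEStronglyMeasurable f volume) (x : ℝ) :
    (∫⁻ y, ENNReal.ofReal (Real.exp (-(κ * |x - y|))) * (‖b y‖ₑ * ‖f y‖ₑ)) ^ 2
      ≤ ENNReal.ofReal Θ * ∫⁻ y, ENNReal.ofReal (Real.exp (-(κ * |x - y|))) * ‖f y‖ₑ ^ 2 := by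
  set e : ℝ → ℝ≥0∞ := fun y => ENNReal.ofReal (Real.exp (-(κ / 2 * |x - y|))) with he
  have hem : Measurable e :=
    (Continuous.measurable (by fun_prop : Continuous fun y : ℝ =>
      Real.exp (-(κ / 2 * |x - y|)))).ennreal_ofReal
  have hee (y : ℝ) : ENNReal.ofReal (Real.exp (-(κ * |x - y|))) = e y * e y := by
    rw [he, ← ENNReal.ofReal_mul (Real.exp_nonneg _), ← Real.exp_add]
    congr 2
    ring
  have h := sq_lintegral_mul_le (hem.aemeasurable.mul hb.meas.enorm)
    (hem.aemeasurable.mul hf.enorm)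
  have hbx := hb.bound x
  simp only [hee] at hbx ⊢
  refine le_trans (le_of_eq ?_) (h.trans (le_trans (le_of_eq ?_) (mul_le_mul_left hbx _)))
  · congr 1
    refine lintegral_congr fun y => ?_
    simp only [Pi.mul_apply]
    ring
  · congr 1 <;> refine lintegral_congr fun y => ?_ <;> simp only [Pi.mul_apply] <;> ring

theorem lintegral_lt_top (hκ : 0 ≤ κ) (hb : SchurBound κ b Θ) (hf : MemLp f 2 volume) (x : ℝ) :
    ∫⁻ y, ENNReal.ofReal (Real.exp (-(κ * |x - y|))) * (‖b y‖ₑ * ‖f y‖ₑ) < ∞ := by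
  have h := hb.sq_lintegral_le hf.1 x
  have h2 : ∫⁻ y, ENNReal.ofReal (Real.exp (-(κ * |x - y|))) * ‖f y‖ₑ ^ 2 < ∞ := by
    refine lt_of_le_of_lt (lintegral_mono fun y => ?_) (lintegral_enorm_sq_lt_top hf)
    refine mul_le_of_le_one_left zero_le ?_
    rw [ENNReal.ofReal_le_one, Real.exp_le_one_iff]
    nlinarith [abs_nonneg (x - y)]
  have h3 := h.trans_lt (ENNReal.mul_lt_top ENNReal.ofReal_lt_top h2)
  by_contra h4
  rw [not_lt, top_le_iff] at h4
  rw [h4] at h3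
  simp at h3

/-- The weighted Cauchy–Schwarz bound uses up `b`. After Tonelli, the symmetry of `|x - y|` lets the
bound on `a` handle the integral in `x`. -/
theorem lintegral_schur (ha : SchurBound κ a Θ') (hb : SchurBound κ b Θ)
    (hf : AEStronglyMeasurable f volume) :
    ∫⁻ x, (‖a x‖ₑ * ∫⁻ y, ENNReal.ofReal (Real.exp (-(κ * |x - y|))) * (‖b y‖ₑ * ‖f y‖ₑ)) ^ 2
      ≤ ENNReal.ofReal Θ * ENNReal.ofReal Θ' * ∫⁻ y, ‖f y‖ₑ ^ 2 := by
  have hem : Measurable fun q : ℝ × ℝ => ENNReal.ofReal (Real.exp (-(κ * |q.1 - q.2|))) :=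
    (Continuous.measurable (by fun_prop : Continuous fun q : ℝ × ℝ =>
      Real.exp (-(κ * |q.1 - q.2|)))).ennreal_ofReal
  calc _ ≤ ∫⁻ x, ENNReal.ofReal Θ * ∫⁻ y, ‖a x‖ₑ ^ 2 *
          (ENNReal.ofReal (Real.exp (-(κ * |x - y|))) * ‖f y‖ₑ ^ 2) := by
        refine lintegral_mono fun x => ?_
        rw [mul_pow, lintegral_const_mul' _ _ (ENNReal.pow_ne_top enorm_ne_top),
          mul_left_comm]
        exact mul_le_mul_right (hb.sq_lintegral_le hf x) _
    _ = ENNReal.ofReal Θ * ∫⁻ x, ∫⁻ y, ‖a x‖ₑ ^ 2 *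
          (ENNReal.ofReal (Real.exp (-(κ * |x - y|))) * ‖f y‖ₑ ^ 2) :=
        lintegral_const_mul' _ _ ENNReal.ofReal_ne_top
    _ = ENNReal.ofReal Θ * ∫⁻ y, ∫⁻ x, ‖a x‖ₑ ^ 2 *
          (ENNReal.ofReal (Real.exp (-(κ * |x - y|))) * ‖f y‖ₑ ^ 2) := by
        congr 1
        refine lintegral_lintegral_swap ?_
        exact (ha.meas.enorm.pow_const 2).comp_fst.mul
          (hem.aemeasurable.mul (hf.enorm.pow_const 2).comp_snd)
    _ ≤ ENNReal.ofReal Θ * ∫⁻ y, ENNReal.ofReal Θ' * ‖f y‖ₑ ^ 2 := by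
        refine mul_le_mul_right (lintegral_mono fun y => ?_) _
        refine le_trans (le_of_eq ?_) (mul_le_mul_left (ha.bound y) _)
        rw [← lintegral_mul_const' _ _ (ENNReal.pow_ne_top enorm_ne_top)]
        refine lintegral_congr fun x => ?_
        rw [abs_sub_comm]
        ring
    _ = _ := by
        rw [lintegral_const_mul' _ _ ENNReal.ofReal_ne_top, mul_assoc]

end SchurBound

/-! ### Integral operators on `L²` -/

section SchurOperator

variable {E : Type*} [NormedAddCommGroup E] [NormedSpace ℂ E]
  {G : ℝ → ℝ → E →L[ℂ] E} {κ C Θ Θ' : ℝ} {a : ℝ → ℂ} {b : ℝ → E →L[ℂ] E}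

theorem enorm_kernel_apply_le (hC : 0 ≤ C) (hG : ∀ x y, ‖G x y‖ ≤ C * Real.exp (-(κ * |x - y|)))
    (x y : ℝ) (v : E) : ‖G x y (b y v)‖ₑ
      ≤ ENNReal.ofReal C * (ENNReal.ofReal (Real.exp (-(κ * |x - y|))) * (‖b y‖ₑ * ‖v‖ₑ)) := by
  rw [← mul_assoc, ← ENNReal.ofReal_mul hC]
  refine ((G x y).le_opENorm _).trans (mul_le_mul' ?_ ((b y).le_opENorm _))
  rw [← ofReal_norm]
  exact ENNReal.ofReal_le_ofReal (hG x y)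

theorem aestronglyMeasurable_kernel_apply
    (hGm : StronglyMeasurable (fun q : ℝ × ℝ => G q.1 q.2)) (hb : AEStronglyMeasurable b volume)
    {f : ℝ → E} (hf : AEStronglyMeasurable f volume) :
    AEStronglyMeasurable (fun q : ℝ × ℝ => G q.1 q.2 (b q.2 (f q.2)))
      ((volume : Measure ℝ).prod volume) :=
  (ContinuousLinearMap.id ℂ (E →L[ℂ] E)).aestronglyMeasurable_comp₂ hGm.aestronglyMeasurable
    ((ContinuousLinearMap.id ℂ (E →L[ℂ] E)).aestronglyMeasurable_comp₂ hb hf).comp_snd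

theorem SchurBound.integrable_kernel_apply (hκ : 0 ≤ κ) (hC : 0 ≤ C)
    (hGm : StronglyMeasurable (fun q : ℝ × ℝ => G q.1 q.2))
    (hG : ∀ x y, ‖G x y‖ ≤ C * Real.exp (-(κ * |x - y|)))
    (hb : SchurBound κ b Θ) {f : ℝ → E} (hf : MemLp f 2 volume) (x : ℝ) :
    Integrable (fun y => G x y (b y (f y))) := by
  refine ⟨?_, ?_⟩
  · have hx : StronglyMeasurable (fun y => G x y) :=
      hGm.comp_measurable (measurable_const.prodMk measurable_id)
    exact (ContinuousLinearMap.id ℂ (E →L[ℂ] E)).aestronglyMeasurable_comp₂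
      hx.aestronglyMeasurable
      ((ContinuousLinearMap.id ℂ (E →L[ℂ] E)).aestronglyMeasurable_comp₂ hb.meas hf.1)
  · refine lt_of_le_of_lt (lintegral_mono fun y => enorm_kernel_apply_le hC hG x y (f y)) ?_
    rw [lintegral_const_mul' _ _ ENNReal.ofReal_ne_top]
    exact ENNReal.mul_lt_top ENNReal.ofReal_lt_top (hb.lintegral_lt_top hκ hf x)

/-- The scalar kernel `e^{-κ|x-y|}` at `x = 0`; this supplies the integrability hypothesis of the
Green kernel lemmas. -/
theorem SchurBound.integrable_exp_smul (hκ : 0 ≤ κ) (hb : SchurBound κ b Θ) {f : ℝ → E}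
    (hf : MemLp f 2 volume) : Integrable (fun y => Real.exp (-(κ * |y|)) • b y (f y)) := by
  have h := hb.integrable_kernel_apply (C := 1)
    (G := fun x y => ((Real.exp (-(κ * |x - y|)) : ℝ) : ℂ) • ContinuousLinearMap.id ℂ E) hκ
    zero_le_one ?_ (fun x y => ?_) hf 0
  · simpa only [zero_sub, abs_neg, smul_apply, ContinuousLinearMap.id_apply, Complex.coe_smul]
      using h
  · exact StronglyMeasurable.smul (f := fun q : ℝ × ℝ =>
      ((Real.exp (-(κ * |q.1 - q.2|)) : ℝ) : ℂ)) (Continuous.stronglyMeasurable (by fun_prop))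
      stronglyMeasurable_const
  · rw [norm_smul, Complex.norm_real, Real.norm_of_nonneg (Real.exp_nonneg _), mul_comm]
    exact mul_le_mul_of_nonneg_right ContinuousLinearMap.norm_id_le (Real.exp_nonneg _)

theorem SchurBound.eLpNorm_le (hC : 0 ≤ C) (hΘ : 0 ≤ Θ) (hΘ' : 0 ≤ Θ')
    (hG : ∀ x y, ‖G x y‖ ≤ C * Real.exp (-(κ * |x - y|)))
    (ha : SchurBound κ a Θ') (hb : SchurBound κ b Θ) {f : ℝ → E}
    (hf : AEStronglyMeasurable f volume) :
    eLpNorm (fun x => a x • ∫ y, G x y (b y (f y))) 2 volume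
      ≤ ENNReal.ofReal (C * Real.sqrt (Θ * Θ')) * eLpNorm f 2 volume := by
  refine eLpNorm_two_le_of_lintegral_sq_le ?_
  have h := ha.lintegral_schur hb hf
  calc _ ≤ ∫⁻ x, ENNReal.ofReal C ^ 2 * (‖a x‖ₑ *
          ∫⁻ y, ENNReal.ofReal (Real.exp (-(κ * |x - y|))) * (‖b y‖ₑ * ‖f y‖ₑ)) ^ 2 := by
        refine lintegral_mono fun x => ?_
        rw [← mul_pow]
        refine pow_le_pow_left₀ zero_le ?_ 2
        rw [enorm_smul, mul_left_comm, ← lintegral_const_mul' _ _ ENNReal.ofReal_ne_top]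
        exact mul_le_mul_right ((enorm_integral_le_lintegral_enorm _).trans
          (lintegral_mono fun y => enorm_kernel_apply_le hC hG x y (f y))) _
    _ ≤ ENNReal.ofReal C ^ 2 * (ENNReal.ofReal Θ * ENNReal.ofReal Θ' * ∫⁻ y, ‖f y‖ₑ ^ 2) := by
        rw [lintegral_const_mul' _ _ (ENNReal.pow_ne_top ENNReal.ofReal_ne_top)]
        exact mul_le_mul_right h _
    _ = _ := by
        rw [← mul_assoc, ← ENNReal.ofReal_mul hΘ, ← ENNReal.ofReal_pow hC,
          ← ENNReal.ofReal_mul (sq_nonneg C), ← ENNReal.ofReal_pow (by positivity), mul_pow,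
          Real.sq_sqrt (mul_nonneg hΘ hΘ')]

/-- The integral operator with kernel `a(x) G(x, y) b(y)` on `L²(ℝ; E)`. -/
theorem exists_schur_operator (hκ : 0 ≤ κ) (hC : 0 ≤ C) (hΘ : 0 ≤ Θ) (hΘ' : 0 ≤ Θ')
    (hGm : StronglyMeasurable (fun q : ℝ × ℝ => G q.1 q.2))
    (hG : ∀ x y, ‖G x y‖ ≤ C * Real.exp (-(κ * |x - y|)))
    (ha : SchurBound κ a Θ') (hb : SchurBound κ b Θ) :
    ∃ O : Lp E 2 (volume : Measure ℝ) →L[ℂ] Lp E 2 (volume : Measure ℝ),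
      (∀ f, O f =ᵐ[volume] fun x => a x • ∫ y, G x y (b y (f y))) ∧
        ‖O‖ ≤ C * Real.sqrt (Θ * Θ') := by
  have hmem (f : Lp E 2 (volume : Measure ℝ)) :
      MemLp (fun x => a x • ∫ y, G x y (b y (f y))) 2 volume := by
    refine ⟨ha.meas.smul (aestronglyMeasurable_kernel_apply hGm hb.meas
      (Lp.aestronglyMeasurable f)).integral_prod_right', ?_⟩
    exact (SchurBound.eLpNorm_le hC hΘ hΘ' hG ha hb (Lp.aestronglyMeasurable f)).trans_lt
      (ENNReal.mul_lt_top ENNReal.ofReal_lt_top (Lp.memLp f).2)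
  have hint (f : Lp E 2 (volume : Measure ℝ)) (x : ℝ) :=
    hb.integrable_kernel_apply hκ hC hGm hG (Lp.memLp f) x
  let L : Lp E 2 (volume : Measure ℝ) →ₗ[ℂ] Lp E 2 (volume : Measure ℝ) :=
    { toFun := fun f => (hmem f).toLp _
      map_add' := fun f g => by
        rw [← MemLp.toLp_add]
        refine MemLp.toLp_congr _ _ (Eventually.of_forall fun x => ?_)
        simp only [Pi.add_apply]
        rw [← smul_add, ← integral_add (hint f x) (hint g x)]
        congr 1
        refine integral_congr_ae ?_
        filter_upwards [Lp.coeFn_add f g] with y hy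
        rw [hy, Pi.add_apply, map_add, map_add]
      map_smul' := fun c f => by
        rw [RingHom.id_apply, ← MemLp.toLp_const_smul]
        refine MemLp.toLp_congr _ _ (Eventually.of_forall fun x => ?_)
        simp only [Pi.smul_apply]
        rw [smul_comm, ← integral_smul c (fun y => G x y (b y (f y)))]
        congr 1
        refine integral_congr_ae ?_
        filter_upwards [Lp.coeFn_smul c f] with y hy
        rw [hy, Pi.smul_apply, map_smul, map_smul] }
  refine ⟨L.mkContinuous (C * Real.sqrt (Θ * Θ')) fun f => ?_, fun f => (hmem f).coeFn_toLp,
    L.mkContinuous_norm_le (by positivity) _⟩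
  change ‖(hmem f).toLp _‖ ≤ _
  rw [Lp.norm_toLp, Lp.norm_def, ← ENNReal.toReal_ofReal (by positivity : 0 ≤ C * √(Θ * Θ')),
    ← ENNReal.toReal_mul]
  exact ENNReal.toReal_mono (ENNReal.mul_ne_top ENNReal.ofReal_ne_top (Lp.memLp f).2.ne)
    (SchurBound.eLpNorm_le hC hΘ hΘ' hG ha hb (Lp.aestronglyMeasurable f))

end SchurOperator

/-! ### From matrix entries to operators on spinors -/

theorem act_eq_sum (M : Matrix (Fin 2) (Fin 2) ℂ) :
    act M = ∑ i, ∑ j, M i j • act (Matrix.single i j 1) := by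
  conv_lhs => rw [Matrix.matrix_eq_sum_single M]
  simp only [act, map_sum]
  refine Finset.sum_congr rfl fun i _ => Finset.sum_congr rfl fun j _ => ?_
  rw [← map_smul, Matrix.smul_single, smul_eq_mul, mul_one]

theorem memLp_smul_const {E : Type*} [NormedAddCommGroup E] [NormedSpace ℂ E] {p : ℝ≥0∞}
    {f : ℝ → ℂ} (hf : MemLp f p volume) (v : E) : MemLp (fun x => f x • v) p volume :=
  (ContinuousLinearMap.toSpanSingleton ℂ v).comp_memLp' hf

theorem memLp_sum_smul {E : Type*} [NormedAddCommGroup E] [NormedSpace ℂ E] {p : ℝ≥0∞}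
    {V : ℝ → Matrix (Fin 2) (Fin 2) ℂ} (hV : ∀ i j : Fin 2, MemLp (fun x : ℝ => V x i j) p volume)
    (T : Fin 2 → Fin 2 → E) : MemLp (fun x => ∑ i, ∑ j, V x i j • T i j) p volume :=
  memLp_finsetSum _ fun i _ => memLp_finsetSum _ fun j _ => memLp_smul_const (hV i j) (T i j)

theorem memLp_act {V : ℝ → Matrix (Fin 2) (Fin 2) ℂ} {p : ℝ≥0∞}
    (hV : ∀ i j : Fin 2, MemLp (fun x : ℝ => V x i j) p volume) :
    MemLp (fun x => act (V x)) p volume := by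
  have e : (fun x => act (V x)) =
      fun x => ∑ i, ∑ j, V x i j • act (Matrix.single i j 1) := funext fun x => act_eq_sum (V x)
  rw [e]
  exact memLp_sum_smul hV _

/-- Collects what the solution theory needs. As `J` inverts `-iσ₁`, the last three identities make
`F' = M F + Jψ` equivalent to `-iσ₁F' + mσ₃F = zF + ψ`. -/
theorem exists_symbol_factorization {m : ℝ} {z : ℂ}
    (hz : ∀ t : ℝ, t ≤ -m ∨ m ≤ t → z ≠ (t : ℂ)) :
    ∃ P Q M J : Spinor →L[ℂ] Spinor,
      (P * M = (Complex.I * waveNumber m z) • P ∧ Q * M = -(Complex.I * waveNumber m z) • Q) ∧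
      (M * P = (Complex.I * waveNumber m z) • P ∧ M * Q = -(Complex.I * waveNumber m z) • Q) ∧
      P + Q = 1 ∧ ‖P * J‖ ≤ eta ‖Phi m z‖ ∧ ‖Q * J‖ ≤ eta ‖Phi m z‖ ∧
      (∀ v, -Complex.I • act sigma1 (M v) = z • v - (m : ℂ) • act sigma3 v) ∧
      (∀ v, -Complex.I • act sigma1 (J v) = v) ∧ ∀ v, J (-Complex.I • act sigma1 v) = v := by
  obtain ⟨ζ, hζ, h1, h2, h3⟩ := exists_parameter hz
  set k := waveNumber m z
  have hs (v : Spinor) : act sigma1 (act sigma1 v) = v := by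
    have h : act sigma1 * act sigma1 = 1 := by
      rw [act, ← map_mul, sigma1_mul_self, map_one]
    exact DFunLike.congr_fun h v
  refine ⟨act (spectralProj ζ), act (spectralProj (-ζ)), act (symbol k ζ),
    Complex.I • act sigma1, ⟨?_, ?_⟩, ⟨?_, ?_⟩, ?_, ?_, ?_, ?_, ?_, ?_⟩
  · rw [act, act, ← map_mul, spectralProj_mul_symbol k hζ, map_smul]
  · rw [act, act, ← map_mul, spectralProj_neg_mul_symbol k hζ, map_smul]
  · rw [act, act, ← map_mul, symbol_mul_spectralProj k hζ, map_smul]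
  · rw [act, act, ← map_mul, symbol_mul_spectralProj_neg k hζ, map_smul]
  · rw [act, act, ← map_add, spectralProj_add_neg, map_one]
  · rw [mul_smul_comm, norm_smul, Complex.norm_I, one_mul, ← h3, act, act, ← map_mul]
    exact norm_act_spectralProj_mul_sigma1_le hζ
  · rw [mul_smul_comm, norm_smul, Complex.norm_I, one_mul, ← h3, act, act, ← map_mul,
      ← norm_neg ζ]
    exact norm_act_spectralProj_mul_sigma1_le (neg_ne_zero.mpr hζ)
  · intro v
    have h : act (symbol k ζ) = Complex.I • (act sigma1 * (z • 1 - (m : ℂ) • act sigma3)) := by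
      rw [symbol_eq m z k ζ h1 h2, act, map_smul, map_mul, map_sub, map_smul, map_smul, map_one]
    rw [h]
    simp only [smul_apply, mul_apply_eq_comp, sub_apply, map_smul, hs, smul_smul]
    simp
  · intro v
    simp only [smul_apply, map_smul, hs, smul_smul]
    simp
  · intro v
    simp only [smul_apply, map_smul, hs, smul_smul]
    simp

/-- A square integrable function is small at arbitrarily large arguments. -/
theorem exists_norm_lt_of_memLp_two {E : Type*} [NormedAddCommGroup E] {F : ℝ → E}
    (hF : MemLp F 2 volume) {ε : ℝ} (hε : 0 < ε) {s : Set ℝ} (hs : volume s = ∞) :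
    ∃ x ∈ s, ‖F x‖ < ε := by
  by_contra! h
  lift ε to NNReal using hε.le
  have h1 := hF.meas_ge_lt_top two_ne_zero ENNReal.ofNat_ne_top (ε := ε) (by exact_mod_cast hε.ne')
  refine (lt_of_le_of_lt (measure_mono (t := {x | ε ≤ ‖F x‖₊}) ?_) h1).ne hs
  exact fun x hx => h x hx

/-! ### Injectivity and right inverse for `H - z` -/

section Solve

variable {m : ℝ} {V : ℝ → Matrix (Fin 2) (Fin 2) ℂ} {z : ℂ} {Θ : ℝ}

/-- Under the smallness condition `z` is not an eigenvalue. -/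
theorem eq_zero_of_mem_diracGraph (hz : ∀ t : ℝ, t ≤ -m ∨ m ≤ t → z ≠ (t : ℂ))
    (hVl : LocallyIntegrable (fun x => act (V x)) volume)
    (hVi : ∀ x, Integrable (fun y => Real.exp (-((waveNumber m z).im * |x - y|)) * ‖act (V y)‖))
    (hVΘ : ∀ x, ∫ y, Real.exp (-((waveNumber m z).im * |x - y|)) * ‖act (V y)‖ ≤ Θ)
    (hΘ : eta ‖Phi m z‖ * Θ < 1) {f : Hilb} (hf : (f, z • f) ∈ diracGraph m V) : f = 0 := by
  obtain ⟨P, Q, M, J, ⟨hPM, hQM⟩, -, hPQ, hPJ, hQJ, hM, -, hJ⟩ := exists_symbol_factorization hz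
  obtain ⟨u, ⟨hu, F, hfF, hFu⟩, hg⟩ := hf
  have hF0 : IsPrimitive F u := ⟨hu, hFu⟩
  have hFc := hF0.continuous
  have hF : IsPrimitive F (fun x => M (F x) + J (-(act (V x) (F x)))) := by
    refine hF0.congr ?_
    filter_upwards [hfF, hg, Lp.coeFn_smul z f] with x h1 h2 h3
    have h2 : (z • f : Hilb) x = -Complex.I • act sigma1 (u x) + (m : ℂ) • act sigma3 (f x)
      + act (V x) (f x) := h2
    rw [h3, Pi.smul_apply, h1] at h2
    rw [← hJ (u x), ← hJ (M (F x)), hM, ← map_add]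
    congr 1
    rw [h2]
    abel
  have hψ : LocallyIntegrable (fun x => -(act (V x) (F x))) volume := by
    have hn : LocallyIntegrable (fun x => ‖F x‖ • act (V x)) volume :=
      hVl.continuous_smul hFc.norm
    refine hn.mono ?_ (Eventually.of_forall fun x => ?_)
    · exact ((ContinuousLinearMap.id ℂ (Spinor →L[ℂ] Spinor)).aestronglyMeasurable_comp₂
        hVl.aestronglyMeasurable hFc.aestronglyMeasurable).neg
    · rw [norm_neg, norm_smul, norm_norm, mul_comm]
      exact (act (V x)).le_opNorm _
  have hη : 0 ≤ eta ‖Phi m z‖ := Real.sqrt_nonneg _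
  have hbound {a b x : ℝ} (hx : x ∈ Icc a b) :
      (1 - eta ‖Phi m z‖ * Θ) * ‖F x‖ ≤ ‖P‖ * ‖F a‖ + ‖Q‖ * ‖F b‖ := by
    have hab : a ≤ b := hx.1.trans hx.2
    -- The estimate is taken at a maximum point of `‖F‖` on `[a, b]`, so the potential term is at
    -- most `ηΘ‖F x₀‖` and can be absorbed. Compactness is needed because `F` is not known to be
    -- bounded on the line.
    obtain ⟨x₀, hx₀, hmax⟩ := (isCompact_Icc (a := a) (b := b)).exists_isMaxOn ⟨x, hx⟩
      hFc.norm.continuousOn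
    have h1 := norm_le_of_isPrimitive (waveNumber_im_pos hz).le hPM hQM hPQ hPJ hQJ hF hψ hx₀
    have h2 : ∫ y in a..b, eta ‖Phi m z‖ * (Real.exp (-((waveNumber m z).im * |x₀ - y|)) *
        ‖-(act (V y) (F y))‖) ≤ eta ‖Phi m z‖ * Θ * ‖F x₀‖ := by
      have hi : Integrable (fun y => eta ‖Phi m z‖ * ‖F x₀‖ *
          (Real.exp (-((waveNumber m z).im * |x₀ - y|)) * ‖act (V y)‖)) := (hVi x₀).const_mul _
      calc _ ≤ ∫ y in a..b, eta ‖Phi m z‖ * ‖F x₀‖ *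
            (Real.exp (-((waveNumber m z).im * |x₀ - y|)) * ‖act (V y)‖) := by
            refine intervalIntegral.integral_mono_on hab ?_ hi.intervalIntegrable fun y hy => ?_
            · have hn : LocallyIntegrable (fun x => ‖-(act (V x) (F x))‖) volume := fun x =>
                let ⟨s, hs, hi⟩ := hψ x
                ⟨s, hs, Integrable.norm hi⟩
              have h := hn.continuous_smul (g := fun y : ℝ => eta ‖Phi m z‖ *
                Real.exp (-((waveNumber m z).im * |x₀ - y|))) (by fun_prop)
              simpa only [smul_eq_mul, mul_assoc] using
                intervalIntegrable_of_locallyIntegrable h a b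
            · rw [norm_neg, mul_assoc, mul_left_comm ‖F x₀‖, mul_comm ‖F x₀‖]
              gcongr
              exact (act (V y)).le_opNorm_of_le (hmax hy)
        _ ≤ ∫ y, eta ‖Phi m z‖ * ‖F x₀‖ *
            (Real.exp (-((waveNumber m z).im * |x₀ - y|)) * ‖act (V y)‖) := by
            rw [intervalIntegral.integral_of_le hab]
            exact setIntegral_le_integral hi (Eventually.of_forall fun y => by positivity)
        _ ≤ _ := by
            rw [integral_const_mul, mul_right_comm]
            exact mul_le_mul_of_nonneg_right (mul_le_mul_of_nonneg_left (hVΘ x₀) hη)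
              (norm_nonneg _)
    calc _ ≤ (1 - eta ‖Phi m z‖ * Θ) * ‖F x₀‖ :=
          mul_le_mul_of_nonneg_left (hmax hx) (by linarith)
      _ ≤ _ := by linarith
  have hFL : MemLp F 2 volume := (memLp_congr_ae hfF).mp (Lp.memLp f)
  have hFz (x : ℝ) : F x = 0 := by
    by_contra hne
    have hpos : 0 < (1 - eta ‖Phi m z‖ * Θ) * ‖F x‖ :=
      mul_pos (by linarith) (norm_pos_iff.mpr hne)
    obtain ⟨ε, hε, hε'⟩ : ∃ ε, 0 < ε ∧ (‖P‖ + ‖Q‖) * ε < (1 - eta ‖Phi m z‖ * Θ) * ‖F x‖ :=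
      exists_pos_mul_lt hpos _
    obtain ⟨a, ha, ha'⟩ := exists_norm_lt_of_memLp_two hFL hε (s := Iic x) Real.volume_Iic
    obtain ⟨b, hb, hb'⟩ := exists_norm_lt_of_memLp_two hFL hε (s := Ici x) Real.volume_Ici
    have h := hbound (a := a) (b := b) (x := x) ⟨ha, hb⟩
    have h1 := mul_le_mul_of_nonneg_left ha'.le (norm_nonneg P)
    have h2 := mul_le_mul_of_nonneg_left hb'.le (norm_nonneg Q)
    linarith
  rw [Lp.eq_zero_iff_ae_eq_zero]
  filter_upwards [hfF] with x hx
  rw [hx, hFz x]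
  rfl

/-- Under the smallness condition `H - z` has a bounded right inverse. -/
theorem exists_right_inverse (hz : ∀ t : ℝ, t ≤ -m ∨ m ≤ t → z ≠ (t : ℂ))
    (hVm : AEStronglyMeasurable (fun x => act (V x)) volume)
    (hVi : ∀ x, Integrable (fun y => Real.exp (-((waveNumber m z).im * |x - y|)) * ‖act (V y)‖))
    (hVΘ : ∀ x, ∫ y, Real.exp (-((waveNumber m z).im * |x - y|)) * ‖act (V y)‖ ≤ Θ)
    (hΘ : eta ‖Phi m z‖ * Θ < 1) :
    ∃ R : Hilb →L[ℂ] Hilb, ∀ h, (R h, h + z • R h) ∈ diracGraph m V := by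
  obtain ⟨P, Q, M, J, -, ⟨hMP, hMQ⟩, hPQ, hPJ, hQJ, hM, hJ, -⟩ := exists_symbol_factorization hz
  have hκ := waveNumber_im_pos hz
  set k := waveNumber m z
  set η := eta ‖Phi m z‖
  have hη : 0 ≤ η := Real.sqrt_nonneg _
  have hΘ0 : 0 ≤ Θ := le_trans (integral_nonneg fun y => by positivity) (hVΘ 0)
  set A := P * J with hA
  set B := -(Q * J) with hB
  have hMA : M * A = (Complex.I * k) • A := by
    rw [hA, ← mul_assoc, hMP, smul_mul_assoc]
  have hMB : M * B = -(Complex.I * k) • B := by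
    refine ContinuousLinearMap.ext fun v => ?_
    change M (-(Q (J v))) = -(Complex.I * k) • -(Q (J v))
    rw [map_neg, smul_neg]
    exact congrArg Neg.neg (DFunLike.congr_fun hMQ (J v))
  have hAB : A - B = J := by
    rw [hA, hB, sub_neg_eq_add, ← add_mul, hPQ, one_mul]
  have hG := norm_kernel_le (k := k) hPJ ((norm_neg _).trans_le hQJ : ‖B‖ ≤ η)
  have hGm := stronglyMeasurable_kernel k A B
  -- Birman–Schwinger splitting `V = sU`. Where `V` vanishes, `s = 0` and the convention `0⁻¹ = 0`
  -- gives `U = 0`, so the norm identities hold everywhere.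
  set s : ℝ → ℂ := fun x => (Real.sqrt ‖act (V x)‖ : ℝ) with hs
  set U : ℝ → Spinor →L[ℂ] Spinor := fun x => (s x)⁻¹ • act (V x) with hU
  have hsn (x : ℝ) : ‖s x‖ ^ 2 = ‖act (V x)‖ := by
    rw [hs, Complex.norm_real, Real.norm_of_nonneg (Real.sqrt_nonneg _),
      Real.sq_sqrt (norm_nonneg _)]
  have hsU (x : ℝ) : act (V x) = s x • U x := by
    rcases eq_or_ne (s x) 0 with h0 | h0
    · have h1 := hsn x
      rw [h0, norm_zero, zero_pow two_ne_zero] at h1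
      rw [h0, zero_smul ℂ (U x), norm_eq_zero.mp h1.symm]
    · rw [hU, smul_inv_smul₀ h0]
  have hUn (x : ℝ) : ‖U x‖ ^ 2 = ‖act (V x)‖ := by
    rw [hU, norm_smul, mul_pow, norm_inv, inv_pow, hsn, sq]
    rcases eq_or_ne ‖act (V x)‖ 0 with h0 | h0
    · rw [h0, mul_zero, mul_zero]
    · rw [inv_mul_cancel_left₀ h0]
  have hsm : AEStronglyMeasurable s volume :=
    Complex.continuous_ofReal.comp_aestronglyMeasurable
      (Real.continuous_sqrt.comp_aestronglyMeasurable hVm.norm)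
  have hUm : AEStronglyMeasurable U volume :=
    hsm.aemeasurable.inv.aestronglyMeasurable.smul hVm
  have bs : SchurBound k.im s Θ := SchurBound.of_integral hsm (by simpa only [hsn] using hVi)
    (by simpa only [hsn] using hVΘ)
  have bU : SchurBound k.im U Θ := SchurBound.of_integral hUm (by simpa only [hUn] using hVi)
    (by simpa only [hUn] using hVΘ)
  have b1 : SchurBound k.im (fun _ => (1 : ℂ)) (2 / k.im) :=
    SchurBound.of_integral aestronglyMeasurable_const
      (by simpa using fun x => (integrable_exp_neg_mul_abs_sub hκ x).1)
      (by simpa using fun x => (integrable_exp_neg_mul_abs_sub hκ x).2.le)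
  have b1' : SchurBound k.im (fun _ => (1 : Spinor →L[ℂ] Spinor)) (2 / k.im) :=
    SchurBound.of_integral aestronglyMeasurable_const
      (by simpa using fun x => (integrable_exp_neg_mul_abs_sub hκ x).1)
      (by simpa using fun x => (integrable_exp_neg_mul_abs_sub hκ x).2.le)
  have hc : 0 ≤ 2 / k.im := by positivity
  -- With `G` the free resolvent, formally `R₀ = G`, `S = GU`, `T = sG` and `K = sGU`. The first
  -- three need only be bounded; the norm of `K` must be below `1` for the Neumann series.
  obtain ⟨R₀, hR₀, -⟩ := exists_schur_operator hκ.le hη hc hc hGm hG b1 b1'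
  obtain ⟨S, hS, -⟩ := exists_schur_operator hκ.le hη hΘ0 hc hGm hG b1 bU
  obtain ⟨T, hT, -⟩ := exists_schur_operator hκ.le hη hc hΘ0 hGm hG bs b1'
  obtain ⟨K, hK, hKn⟩ := exists_schur_operator hκ.le hη hΘ0 hΘ0 hGm hG bs bU
  rw [Real.sqrt_mul_self hΘ0] at hKn
  obtain ⟨N, hN⟩ : ∃ N : Hilb →L[ℂ] Hilb, (1 + K) * N = 1 := by
    have h : IsUnit (1 - -K) := isUnit_one_sub_of_norm_lt_one
      (by rw [norm_neg]; exact hKn.trans_lt hΘ)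
    rw [sub_neg_eq_add] at h
    exact h.exists_right_inv
  -- For `F = G(h - VF)` put `g = sF`, so `VF = Ug`. Multiplying by `s` gives `(1 + K)g = Th`, and
  -- then `F = R₀h - Sg`.
  refine ⟨R₀ - S * N * T, fun h => ?_⟩
  set g : Hilb := N (T h) with hg
  have hgK : g + K g = T h := DFunLike.congr_fun hN (T h)
  set φ : ℝ → Spinor := fun y => h y - U y (g y) with hφ
  have i1 (x : ℝ) := b1'.integrable_kernel_apply hκ.le hη hGm hG (Lp.memLp h) x
  have i2 (x : ℝ) := bU.integrable_kernel_apply hκ.le hη hGm hG (Lp.memLp g) x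
  have hφi : Integrable (fun y => Real.exp (-(k.im * |y|)) • φ y) := by
    have h1 := (b1'.integrable_exp_smul hκ.le (Lp.memLp h)).sub
      (bU.integrable_exp_smul hκ.le (Lp.memLp g))
    refine h1.congr (Eventually.of_forall fun y => ?_)
    simp [hφ, smul_sub]
  set F : ℝ → Spinor := fun x => ∫ y, kernel k A B x y (φ y) with hF
  have hFe (x : ℝ) : F x = (∫ y, kernel k A B x y (h y)) - ∫ y, kernel k A B x y (U y (g y)) := by
    rw [hF]
    simp only [hφ, map_sub]
    exact integral_sub (i1 x) (i2 x)
  have hRF : ((R₀ - S * N * T) h : Hilb) =ᵐ[volume] F := by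
    filter_upwards [Lp.coeFn_sub (R₀ h) (S g), hR₀ h, hS g] with x h1 h2 h3
    have h1 : ((R₀ - S * N * T) h : Hilb) x = (R₀ h - S g : Hilb) x ∧
      (R₀ h - S g : Hilb) x = R₀ h x - S g x := ⟨rfl, h1⟩
    rw [h1.1, h1.2, h2, h3, hFe]
    simp
  -- The equation for `g` closes the loop: `sF = Th - Kg = g`, hence `Ug = VF`.
  have hsF : ∀ᵐ x, s x • F x = g x := by
    filter_upwards [hT h, hK g, Lp.coeFn_add g (K g)] with x h1 h2 h3
    rw [hgK, Pi.add_apply, h1, h2] at h3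
    rw [hFe, smul_sub]
    exact sub_eq_iff_eq_add.mpr h3
  have hprim := isPrimitive_integral_kernel hκ.le hMA hMB hAB hφi
  refine ⟨fun x => M (F x) + J (φ x), ⟨hprim.1, F, hRF, hprim.2⟩, ?_⟩
  filter_upwards [hRF, hsF, Lp.coeFn_add h (z • (R₀ - S * N * T) h),
    Lp.coeFn_smul z ((R₀ - S * N * T) h)] with x h1 h2 h3 h4
  change (h + z • (R₀ - S * N * T) h : Hilb) x = _
  have hV : act (V x) (F x) = U x (g x) := by
    rw [hsU, ← h2, map_smul]
    rfl
  rw [h3, Pi.add_apply, h4, Pi.smul_apply, h1, map_add, smul_add, hM, hJ, hV, hφ]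
  have key (a b c d : Spinor) : a + b = b - c + (a - d) + c + d := by abel
  exact key _ _ _ _

end Solve

end Dirac1D

end

/-! ### The resolvent of the Dirac operator -/

theorem mainTheorem6 (m : ℝ) (hm : 0 ≤ m) (p : ℝ) (hp : 1 < p)
    (V : ℝ → Matrix (Fin 2) (Fin 2) ℂ)
    (hV : ∀ i j : Fin 2, MemLp (fun x : ℝ => V x i j) (ENNReal.ofReal p) volume)
    (z : ℂ) (hz : ∀ t : ℝ, t ≤ -m ∨ m ≤ t → z ≠ (t : ℂ))
    (hVz : Dirac1D.eta ‖Dirac1D.Phi m z‖ * (2 * (p - 1) / p) ^ ((p - 1) / p)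
      * (Dirac1D.waveNumber m z).im ^ (-((p - 1) / p)) * Dirac1D.potNorm p V < 1) :
    z ∉ Dirac1D.spectrum (Dirac1D.diracOp m V) := by
  have hVp := Dirac1D.memLp_act hV
  have hb := fun x => Dirac1D.integral_exp_mul_le hp (Dirac1D.waveNumber_im_pos hz)
    (fun y => norm_nonneg (Dirac1D.act (V y))) hVp.norm x
  have hΘ : Dirac1D.eta ‖Dirac1D.Phi m z‖ * ((2 * (p - 1) / p) ^ ((p - 1) / p)
      * (Dirac1D.waveNumber m z).im ^ (-((p - 1) / p))
      * (∫ x, ‖Dirac1D.act (V x)‖ ^ p) ^ (1 / p)) < 1 := by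
    refine lt_of_eq_of_lt ?_ hVz
    rw [Dirac1D.potNorm]
    ring
  obtain ⟨R, hR⟩ := Dirac1D.exists_right_inverse hz hVp.1 (fun x => (hb x).1)
    (fun x => (hb x).2) hΘ
  have hgraph := Dirac1D.diracOp_graph m V
  simp only [Dirac1D.spectrum, Set.mem_compl_iff, not_not]
  refine ⟨R, fun h => ?_, fun f => ?_⟩
  · have h1 := hR h
    rw [← hgraph, LinearPMap.mem_graph_iff] at h1
    obtain ⟨y, hy1, hy2⟩ := h1
    have hy1 : (y : Dirac1D.Hilb) = R h := hy1
    have hd : R h ∈ (Dirac1D.diracOp m V).domain := hy1 ▸ y.2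
    refine ⟨hd, ?_⟩
    rw [show (⟨R h, hd⟩ : (Dirac1D.diracOp m V).domain) = y from Subtype.ext hy1.symm, hy2]
    exact add_sub_cancel_right _ _
  · have h1 := hR (Dirac1D.diracOp m V f - z • (f : Dirac1D.Hilb))
    have h2 : ((f : Dirac1D.Hilb), Dirac1D.diracOp m V f) ∈ Dirac1D.diracGraph m V :=
      hgraph ▸ LinearPMap.mem_graph _ f
    -- The right inverse is also a left inverse: `d = R(Hf - zf) - f` satisfies `Hd = zd`, so `d =
    -- 0` by injectivity.
    refine sub_eq_zero.mp (Dirac1D.eq_zero_of_mem_diracGraph hz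
      (hVp.locallyIntegrable (by rw [ENNReal.one_le_ofReal]; exact hp.le))
      (fun x => (hb x).1) (fun x => (hb x).2) hΘ ?_)
    convert! Submodule.sub_mem _ h1 h2 using 1
    refine Prod.ext rfl ?_
    simp only [Prod.snd_sub, smul_sub]
    abel
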